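/- **Lemma (Refined bilinear estimates).** Notation. For $m\ge 0$ and $\xi\in\mathbb R^3$ let $\langle\xi\rangle_m=\sqrt{m^2+|\xi|^2}$, and let $S_m(\pm t)=e^{\mp it\langle D\rangle_m}$ be the free propagators on $L^2(\mathbb R^3;\mathbb C)$, where $D=-i\nabla$ and $\sigma(D)$ denotes the Fourier multiplier $\widehat{\sigma(D)f}(\xi)=\sigma(\xi)\widehat f(\xi)$, with $\widehat f(\xi)=\int_{\mathbb R^3} e^{-ix\cdot\xi}f(x)\,dx$. Fix an even real-valued $\chi\in C_0^\infty((-2,2))$ with $\chi(s)=1$ for $|s|\le1$. For dyadic $\lambda>0$ (that is, $\lambda=2^k$ with $k\in\mathbb Z$) put $\rho_\lambda=0$ if $\lambda<1$, $\rho_1(s)=\chi(s)$, and $\rho_\lambda(s)=\chi(s/\lambda)-\chi(2s/\lambda)$ if $\lambda>1$, and let $P_\lambda=\rho_\lambda(|D|)$. For dyadic $\mu>0$ and $z\in\mathbb Z^3$ let $C_z=\mu z+[0,\mu)^3$ and $P_{C_z}=\mathbb 1_{C_z}(D)$. For $f,g\in L^2(\mathbb R^3)$ and dyadic $\mu,\lambda_1,\lambda_2>0$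 put $f_{z,\lambda_1}=P_{C_z}P_{\lambda_1}f$ and $g_{z',\lambda_2}=P_{C_{z'}}P_{\lambda_2}g$. On the left-hand sides below $\|\cdot\|$ is the norm of $L^2_{t,x}(\mathbb R^{1+3})$, on the right-hand sides that of $L^2_x(\mathbb R^3)$. Statement. There is an absolute constant $N>1$ such that for every $\chi$ as above, every $m\ge0$ and every $K\ge1$ there is a constant $C>0$, depending only on $\chi$, $m$ and $K$, with the following property. For all dyadic $\mu,\lambda_1,\lambda_2>0$ with $N\mu\le\lambda_1$ (i.e. $\mu\ll\lambda_1$) and $K^{-1}\lambda_1\le\lambda_2\le K\lambda_1$ (i.e. $\lambda_1\sim\lambda_2$), all $(z,z')\in\mathbb Z^3\times\mathbb Z^3$ and all $f,g\in L^2(\mathbb R^3)$, the functions on the left below belong to $L^2_{t,x}(\mathbb R^{1+3})$ and: (i) (++) interaction: $$\big\|P_\mu\big(S_m(t)f_{z,\lambda_1}\cdot S_m(t)g_{z',\lambda_2}\big)\big\|\le C\,\mu\,\|f_{z,\lambda_1}\|\,\|g_{z',\lambda_2}\|;$$ (ii) (+−) interaction: $$\big\|P_\mu\big(S_m(t)f_{z,\lambda_1}\cdot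 S_m(-t)g_{z',\lambda_2}\big)\big\|\le C\,(\mu\lambda_1)^{1/2}\,\|f_{z,\lambda_1}\|\,\|g_{z',\lambda_2}\|.$$ -/

import Mathlib

open MeasureTheory
open scoped FourierTransform ContDiff ENNReal

noncomputable section

namespace DiracBilinear

/-- The physical (and frequency) space `ℝ³`, with the Euclidean norm and Lebesgue measure. -/
abbrev R3 : Type := EuclideanSpace ℝ (Fin 3)

/-- The complex Hilbert space `L²(ℝ³)`. -/
abbrev L2 : Type := Lp ℂ 2 (volume : Measure R3)

/-- An even function `χ ∈ C₀^∞((-2, 2))` with `χ(s) = 1` for `|s| ≤ 1`. -/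
structure Cutoff where
  /-- the underlying function -/
  toFun : ℝ → ℝ
  smooth : ContDiff ℝ ∞ toFun
  even : ∀ s, toFun (-s) = toFun s
  support : tsupport toFun ⊆ Set.Ioo (-2) 2
  eq_one : ∀ s, |s| ≤ 1 → toFun s = 1

/-- `μ` is dyadic: `μ = 2^k` for some integer `k`. -/
def IsDyadic (μ : ℝ) : Prop := ∃ k : ℤ, μ = (2 : ℝ) ^ k

/-- The (inhomogeneous) Littlewood-Paley symbol `ρ_l`, for dyadic `l > 0`. -/
def rho (χ : Cutoff) (l s : ℝ) : ℝ :=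
  if l < 1 then 0
  else if l = 1 then χ.toFun s
  else χ.toFun (s / l) - χ.toFun (2 * s / l)

/-- The Japanese bracket `⟨ξ⟩_m = √(m² + |ξ|²)`. -/
def jap (m : ℝ) (ξ : R3) : ℝ := Real.sqrt (m ^ 2 + ‖ξ‖ ^ 2)

/-- The cube `C_z = μ z + [0, μ)³`. -/
def cube (μ : ℝ) (z : Fin 3 → ℤ) : Set R3 :=
  {ξ | ∀ i, μ * z i ≤ ξ i ∧ ξ i < μ * z i + μ}

/-- A bounded measurable symbol, rescaled, multiplies `L²` into itself. -/
theorem memLp_symbol_mul {σ : R3 → ℂ} (hσ : Measurable σ) (hb : ∃ C, ∀ ξ, ‖σ ξ‖ ≤ C) (F : L2) :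
    MemLp (fun ξ => σ ((2 * Real.pi) • ξ) * F ξ) 2 volume := by
  obtain ⟨C, hC⟩ := hb
  refine MemLp.of_le_mul (c := C) (Lp.memLp F) ?_ (Filter.Eventually.of_forall fun ξ => ?_)
  · exact (hσ.comp (measurable_const_smul _)).aestronglyMeasurable.mul
      (Lp.memLp F).aestronglyMeasurable
  · rw [norm_mul]
    exact mul_le_mul_of_nonneg_right (hC _) (norm_nonneg _)

/-- The Fourier multiplier `σ(D)` on `L²(ℝ³)` with bounded measurable symbol `σ`, where
`D = -i∇`, so that `(σ(D) f)^ = σ f^` for the Fourier transform `∫ e^{-i x·ξ} f(x) dx`.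
Mathlib's transform `𝓕` has the kernel `e^{-2πi x·ξ}`, hence the argument `2πξ` of `σ`. -/
def multiplier (σ : R3 → ℂ) (hσ : Measurable σ) (hb : ∃ C, ∀ ξ, ‖σ ξ‖ ≤ C) (f : L2) : L2 :=
  𝓕⁻ ((memLp_symbol_mul hσ hb (𝓕 f)).toLp (fun ξ => σ ((2 * Real.pi) • ξ) * (𝓕 f : L2) ξ))

theorem Cutoff.exists_bound (χ : Cutoff) : ∃ C, ∀ s, |χ.toFun s| ≤ C := by
  have hc : HasCompactSupport χ.toFun :=
    (isCompact_Icc (a := (-2 : ℝ)) (b := 2)).of_isClosed_subset (isClosed_tsupport _)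
      (χ.support.trans Set.Ioo_subset_Icc_self)
  simpa [Real.norm_eq_abs] using hc.exists_bound_of_continuous χ.smooth.continuous

theorem rho_continuous (χ : Cutoff) (l : ℝ) : Continuous (rho χ l) := by
  have h := χ.smooth.continuous
  unfold rho
  split_ifs <;> fun_prop

theorem measurable_rho_symbol (χ : Cutoff) (l : ℝ) :
    Measurable fun ξ : R3 => ((rho χ l ‖ξ‖ : ℝ) : ℂ) :=
  (Complex.continuous_ofReal.comp ((rho_continuous χ l).comp continuous_norm)).measurable

theorem bound_rho_symbol (χ : Cutoff) (l : ℝ) :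
    ∃ C, ∀ ξ : R3, ‖((rho χ l ‖ξ‖ : ℝ) : ℂ)‖ ≤ C := by
  obtain ⟨C, hC⟩ := χ.exists_bound
  have h0 : 0 ≤ C := (abs_nonneg _).trans (hC 0)
  refine ⟨C + C, fun ξ => ?_⟩
  rw [Complex.norm_real, Real.norm_eq_abs]
  unfold rho
  split_ifs
  · simpa using h0
  · linarith [hC ‖ξ‖]
  · exact (abs_sub _ _).trans (add_le_add (hC _) (hC _))

/-- The frequency projection `P_l = ρ_l(|D|)` on `L²(ℝ³)`. -/
def freqProj (χ : Cutoff) (l : ℝ) : L2 → L2 :=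
  multiplier (fun ξ => ((rho χ l ‖ξ‖ : ℝ) : ℂ)) (measurable_rho_symbol χ l) (bound_rho_symbol χ l)

theorem measurableSet_cube (μ : ℝ) (z : Fin 3 → ℤ) : MeasurableSet (cube μ z) := by
  unfold cube
  measurability

/-- The frequency projection `P_{C_z}` onto the cube `C_z`, on `L²(ℝ³)`. -/
def cubeProj (μ : ℝ) (z : Fin 3 → ℤ) : L2 → L2 :=
  multiplier ((cube μ z).indicator fun _ => (1 : ℂ))
    (measurable_const.indicator (measurableSet_cube μ z))
    ⟨1, fun ξ => by
      simpa using norm_indicator_le_norm_self (s := cube μ z) (fun _ => (1 : ℂ)) ξ⟩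

theorem measurable_prop_symbol (m t : ℝ) :
    Measurable fun ξ : R3 => Complex.exp (-Complex.I * ((t * jap m ξ : ℝ) : ℂ)) := by
  unfold jap
  fun_prop

theorem bound_prop_symbol (m t : ℝ) :
    ∃ C, ∀ ξ : R3, ‖Complex.exp (-Complex.I * ((t * jap m ξ : ℝ) : ℂ))‖ ≤ C :=
  ⟨1, fun ξ => by simp [Complex.norm_exp]⟩

/-- The free propagator `S_m(t) = e^{-i t ⟨D⟩_m}` on `L²(ℝ³)`, for every real `t`; in particular
`S_m(-t) = e^{i t ⟨D⟩_m}`. -/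
def propagator (m t : ℝ) : L2 → L2 :=
  multiplier (fun ξ => Complex.exp (-Complex.I * ((t * jap m ξ : ℝ) : ℂ)))
    (measurable_prop_symbol m t) (bound_prop_symbol m t)

/-- The frequency projection `P_μ w = F⁻¹[ρ_μ(|ξ|) F w]` of an integrable function `w`, as a
pointwise defined function. It is applied to products of two `L²` functions, which are integrable:
then `F w` is the classical Fourier integral, and as `ρ_μ` is bounded with bounded support, the
inverse Fourier integral converges absolutely. -/
def freqProjL1 (χ : Cutoff) (μ : ℝ) (w : R3 → ℂ) : R3 → ℂ :=
  𝓕⁻ (fun ξ : R3 => ((rho χ μ ‖(2 * Real.pi) • ξ‖ : ℝ) : ℂ) * 𝓕 w ξ)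

/-- The frequency-localized function `f_{z,l} = P_{C_z} P_l f`, where `C_z` is the cube of
side `μ`. -/
def localized (χ : Cutoff) (μ l : ℝ) (z : Fin 3 → ℤ) (f : L2) : L2 :=
  cubeProj μ z (freqProj χ l f)

/-- The function `(t, x) ↦ P_μ (S_m(t) f · S_m(ε t) g)(x)` on `ℝ^{1+3}`; `ε = 1` is the (++)
interaction and `ε = -1` is the (+-) interaction. -/
def interaction (χ : Cutoff) (m μ ε : ℝ) (f g : L2) : ℝ × R3 → ℂ := fun p =>
  freqProjL1 χ μ (fun x => propagator m p.1 f x * propagator m (ε * p.1) g x) p.2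

end DiracBilinear

end

/-!
On the frequency side the interaction at output frequency `ξ` is, as a function of `t`, an
oscillatory integral over `η` with phase `⟨η⟩ ± ⟨ξ - η⟩`. If the push-forward of Lebesgue measure
on the support of the amplitude under the phase has density at most `M`, then Plancherel in time
followed by Cauchy-Schwarz gives the bilinear `L²` bound with constant `M ^ (1/2)`.

For the (++) phase the support of the amplitude lies in a cube of side `μ` at distance `~ λ₁` from
the origin. If `|ξ| ≲ μ`, the derivative of the phase along the dominant coordinate of the cube is
bounded below, whence `M ≲ μ²`. For arbitrary `ξ` the phase is still convex, with second derivative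
`≳ 1 / λ₁` in the plane orthogonal to the dominant coordinate, and its level sets in that plane have
area `≲ λ₁` per unit length, whence `M ≲ μ λ₁`.

The (+-) phase may degenerate, but `|S(t) a · S(-t) b|² = |S(t) a|² |S(-t) b|²` is controlled by
Cauchy-Schwarz through the squares of `S(t) a · S(t) a` and `S(-t) b · S(-t) b`, which are (++)
products; for them the bound valid for all `ξ` applies, and gives `(μ λ₁) ^ (1/2)`.
-/

noncomputable section

namespace DiracBilinear

section Fourier

variable {V : Type*} [NormedAddCommGroup V] [InnerProductSpace ℝ V] [FiniteDimensional ℝ V]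
  [MeasurableSpace V] [BorelSpace V]

theorem continuous_fourier {f : V → ℂ} (hf : Integrable f) : Continuous (𝓕 f) :=
  VectorFourier.fourierIntegral_continuous Real.continuous_fourierChar
    (by exact continuous_inner) hf

theorem continuous_fourierInv {f : V → ℂ} (hf : Integrable f) : Continuous (𝓕⁻ f) := by
  rw [Real.fourierInv_eq_fourier_comp_neg]
  exact continuous_fourier hf.comp_neg

theorem integral_fourier_schwartz_mul (φ : SchwartzMap V ℂ) {f : V → ℂ} (hf : Integrable f) :
    ∫ x, (𝓕 φ : SchwartzMap V ℂ) x * f x = ∫ x, φ x * 𝓕 f x := by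
  have h := VectorFourier.integral_fourierIntegral_smul_eq_flip (μ := (volume : Measure V))
    (ν := (volume : Measure V)) (L := innerₗ V) Real.continuous_fourierChar
    (by exact continuous_inner) φ.integrable hf
  rwa [flip_innerₗ] at h

theorem integral_fourierInv_schwartz_mul (φ : SchwartzMap V ℂ) {f : V → ℂ} (hf : Integrable f) :
    ∫ x, (𝓕⁻ φ : SchwartzMap V ℂ) x * f x = ∫ x, φ x * 𝓕⁻ f x := by
  rw [Real.fourierInv_eq_fourier_comp_neg, ← integral_fourier_schwartz_mul φ hf.comp_neg,
    ← integral_neg_eq_self]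
  simp only [SchwartzMap.fourierInv_coe, SchwartzMap.fourier_coe, Real.fourierInv_eq_fourier_neg,
    neg_neg]

theorem ae_eq_of_forall_integral_schwartz_mul_eq {f g : V → ℂ} (hf : LocallyIntegrable f)
    (hg : LocallyIntegrable g)
    (h : ∀ φ : SchwartzMap V ℂ, ∫ x, φ x * f x = ∫ x, φ x * g x) : f =ᵐ[volume] g := by
  refine ae_eq_of_integral_contDiff_smul_eq hf hg fun φ hφ hφs ↦ ?_
  simp only [Complex.real_smul]
  exact h ((hφs.comp_left Complex.ofReal_zero).toSchwartzMap
    (Complex.ofRealCLM.contDiff.comp hφ))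

theorem locallyIntegrable_Lp_two (u : Lp ℂ 2 (volume : Measure V)) : LocallyIntegrable u :=
  (Lp.memLp u).locallyIntegrable one_le_two

theorem coeFn_fourier_toLp {f : V → ℂ} (h1 : Integrable f) (h2 : MemLp f 2) :
    (𝓕 (h2.toLp f) : Lp ℂ 2 (volume : Measure V)) =ᵐ[volume] 𝓕 f := by
  refine ae_eq_of_forall_integral_schwartz_mul_eq (locallyIntegrable_Lp_two _)
    (continuous_fourier h1).locallyIntegrable fun φ ↦ ?_
  have h := congrArg (· φ) (Lp.fourier_toTemperedDistribution_eq (h2.toLp f))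
  simp only [TemperedDistribution.fourier_apply, Lp.toTemperedDistribution_apply, smul_eq_mul] at h
  rw [← h, ← integral_fourier_schwartz_mul φ h1]
  exact integral_congr_ae (h2.coeFn_toLp.mono fun x hx ↦ by simp only [hx])

theorem coeFn_fourierInv_toLp {f : V → ℂ} (h1 : Integrable f) (h2 : MemLp f 2) :
    (𝓕⁻ (h2.toLp f) : Lp ℂ 2 (volume : Measure V)) =ᵐ[volume] 𝓕⁻ f := by
  refine ae_eq_of_forall_integral_schwartz_mul_eq (locallyIntegrable_Lp_two _)
    (continuous_fourierInv h1).locallyIntegrable fun φ ↦ ?_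
  have h := congrArg (· φ) (Lp.fourierInv_toTemperedDistribution_eq (h2.toLp f))
  simp only [TemperedDistribution.fourierInv_apply, Lp.toTemperedDistribution_apply,
    smul_eq_mul] at h
  rw [← h, ← integral_fourierInv_schwartz_mul φ h1]
  exact integral_congr_ae (h2.coeFn_toLp.mono fun x hx ↦ by simp only [hx])

theorem eLpNorm_fourier {f : V → ℂ} (h1 : Integrable f) (h2 : MemLp f 2) :
    eLpNorm (𝓕 f) 2 = eLpNorm f 2 := by
  rw [← eLpNorm_congr_ae (coeFn_fourier_toLp h1 h2), ← eLpNorm_congr_ae h2.coeFn_toLp,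
    ← Lp.enorm_def, ← Lp.enorm_def, ← ofReal_norm, ← ofReal_norm, Lp.norm_fourier_eq]

theorem eLpNorm_fourierInv {f : V → ℂ} (h1 : Integrable f) (h2 : MemLp f 2) :
    eLpNorm (𝓕⁻ f) 2 = eLpNorm f 2 := by
  rw [← eLpNorm_fourier h1 h2, show 𝓕⁻ f = 𝓕 f ∘ Neg.neg from
    funext fun x ↦ Real.fourierInv_eq_fourier_neg f x]
  exact eLpNorm_comp_measurePreserving (continuous_fourier h1).aestronglyMeasurable
    (Measure.measurePreserving_neg volume)

theorem memLp_top_of_integrable_fourier {u : Lp ℂ 2 (volume : Measure V)}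
    (h : Integrable (𝓕 u : Lp ℂ 2 (volume : Measure V))) : MemLp u ∞ := by
  have hu := coeFn_fourierInv_toLp h (Lp.memLp (𝓕 u : Lp ℂ 2 (volume : Measure V)))
  rw [Lp.toLp_coeFn, FourierTransform.fourierInv_fourier_eq] at hu
  refine memLp_top_of_bound (C := ∫ x, ‖(𝓕 u : Lp ℂ 2 (volume : Measure V)) x‖) (Lp.memLp u).1 ?_
  filter_upwards [hu] with x hx
  rw [hx]
  exact VectorFourier.norm_fourierIntegral_le_integral_norm _ _ _ _ _

theorem schwartz_fourier_mul (f g : SchwartzMap V ℂ) (ξ : V) :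
    𝓕 (fun x ↦ f x * g x) ξ =
      ∫ η, (𝓕 f : SchwartzMap V ℂ) η * (𝓕 g : SchwartzMap V ℂ) (ξ - η) := by
  have h : SchwartzMap.convolution (ContinuousLinearMap.mul ℂ ℂ) (𝓕⁻ f) (𝓕⁻ g) =
      𝓕⁻ (SchwartzMap.pairing (ContinuousLinearMap.mul ℂ ℂ) f g) := by
    simp [SchwartzMap.convolution]
  calc 𝓕 (fun x ↦ f x * g x) ξ
      = SchwartzMap.convolution (ContinuousLinearMap.mul ℂ ℂ) (𝓕⁻ f) (𝓕⁻ g) (-ξ) := by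
        rw [h, SchwartzMap.fourierInv_coe, Real.fourierInv_eq_fourier_neg, neg_neg]
        congr 1
    _ = ∫ η, (𝓕⁻ f : SchwartzMap V ℂ) (-η) * (𝓕⁻ g : SchwartzMap V ℂ) (-ξ - -η) := by
        rw [SchwartzMap.convolution_apply, convolution_def, ← integral_neg_eq_self]
        simp only [ContinuousLinearMap.mul_apply']
    _ = _ := by
        simp only [SchwartzMap.fourierInv_coe, SchwartzMap.fourier_coe,
          Real.fourierInv_eq_fourier_neg, neg_neg, neg_sub_neg, neg_sub]

theorem continuous_fourier_mul (ξ : V) : Continuous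
    fun p : Lp ℂ 2 (volume : Measure V) × Lp ℂ 2 (volume : Measure V) ↦
      𝓕 (fun x ↦ p.1 x * p.2 x) ξ := by
  let B := ContinuousLinearMap.mul ℂ ℂ
  have he : MemLp (fun x : V ↦ ((Real.fourierChar (-inner ℝ x ξ) : Circle) : ℂ)) ∞ volume :=
    memLp_top_of_bound (Continuous.aestronglyMeasurable (by fun_prop)) 1
      (.of_forall fun x ↦ (Circle.norm_coe _).le)
  have hB (u v : Lp ℂ 2 (volume : Measure V)) : 𝓕 (fun x ↦ u x * v x) ξ =
      B.lpPairing volume 2 2 u (B.holderL volume ∞ 2 2 (he.toLp _) v) := by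
    rw [ContinuousLinearMap.lpPairing_eq_integral, Real.fourier_eq]
    refine integral_congr_ae ?_
    filter_upwards [he.coeFn_toLp, B.coeFn_holder (r := 2) (he.toLp _) v] with x hx hx'
    rw [ContinuousLinearMap.holderL_apply_apply, hx', hx]
    simp only [B, ContinuousLinearMap.mul_apply', Circle.smul_def, smul_eq_mul]
    ring
  simp_rw [hB]
  exact ((B.lpPairing volume 2 2).continuous.comp continuous_fst).clm_apply
    ((B.holderL volume ∞ 2 2 (he.toLp _)).continuous.comp continuous_snd)

theorem continuous_integral_mul_sub (ξ : V) : Continuous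
    fun p : Lp ℂ 2 (volume : Measure V) × Lp ℂ 2 (volume : Measure V) ↦
      ∫ η, p.1 η * p.2 (ξ - η) := by
  let B := ContinuousLinearMap.mul ℂ ℂ
  have hξ := Measure.measurePreserving_sub_left (volume : Measure V) ξ
  have hB (u v : Lp ℂ 2 (volume : Measure V)) : ∫ η, u η * v (ξ - η) =
      B.lpPairing volume 2 2 u (Lp.compMeasurePreserving _ hξ v) := by
    rw [ContinuousLinearMap.lpPairing_eq_integral]
    refine integral_congr_ae ?_
    filter_upwards [Lp.coeFn_compMeasurePreserving v hξ] with x hx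
    rw [hx]
    rfl
  simp_rw [hB]
  exact ((B.lpPairing volume 2 2).continuous.comp continuous_fst).clm_apply
    ((Lp.isometry_compMeasurePreserving hξ).continuous.comp continuous_snd)

theorem fourier_mul_eq_convolution (u v : Lp ℂ 2 (volume : Measure V)) (ξ : V) :
    𝓕 (fun x ↦ u x * v x) ξ =
      ∫ η, (𝓕 u : Lp ℂ 2 (volume : Measure V)) η * (𝓕 v : Lp ℂ 2 (volume : Measure V)) (ξ - η) := by
  have hF := (Lp.fourierTransformₗᵢ V ℂ).continuous
  refine (SchwartzMap.denseRange_toLpCLM (F := ℂ) (μ := (volume : Measure V)) (p := 2)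
    ENNReal.ofNat_ne_top).induction_on₂ (isClosed_eq (continuous_fourier_mul ξ)
      ((continuous_integral_mul_sub ξ).comp (hF.prodMap hF))) (fun f g ↦ ?_) u v
  simp only [SchwartzMap.toLpCLM_apply, SchwartzMap.toLp_fourier_eq]
  calc _ = 𝓕 (fun x ↦ f x * g x) ξ := by
        rw [Real.fourier_eq, Real.fourier_eq]
        refine integral_congr_ae ?_
        filter_upwards [f.coeFn_toLp 2, g.coeFn_toLp 2] with x hf hg
        rw [hf, hg]
    _ = _ := schwartz_fourier_mul f g ξ
    _ = _ := by
        refine integral_congr_ae ?_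
        filter_upwards [(𝓕 f : SchwartzMap V ℂ).coeFn_toLp 2,
          (Measure.measurePreserving_sub_left volume ξ).quasiMeasurePreserving.ae_eq_comp
            ((𝓕 g : SchwartzMap V ℂ).coeFn_toLp 2)] with η hf hg
        rw [hf, ← show _ = (𝓕 g : SchwartzMap V ℂ) (ξ - η) from hg, Function.comp_apply]

end Fourier

section Lintegral

variable {α : Type*} [MeasurableSpace α] {ν : Measure α}

theorem eLpNorm_two_sq {E : Type*} [NormedAddCommGroup E] (ν : Measure α) (f : α → E) :
    eLpNorm f 2 ν ^ 2 = ∫⁻ x, ‖f x‖ₑ ^ 2 ∂ν := by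
  simpa using eLpNorm_nnreal_pow_eq_lintegral (f := f) (μ := ν) (p := 2) two_ne_zero

theorem sq_lintegral_le_of_sq_le_mul {f g h : α → ℝ≥0∞} (hf : AEMeasurable f ν)
    (hg : AEMeasurable g ν) (hfg : ∀ x, h x ^ 2 ≤ f x * g x) :
    (∫⁻ x, h x ∂ν) ^ 2 ≤ (∫⁻ x, f x ∂ν) * ∫⁻ x, g x ∂ν := by
  have sq_sqrt (c : ℝ≥0∞) : (c ^ (1 / 2 : ℝ)) ^ (2 : ℝ) = c := by
    rw [← ENNReal.rpow_mul, one_div_mul_cancel two_ne_zero, ENNReal.rpow_one]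
  have hle (x : α) : h x ≤ f x ^ (1 / 2 : ℝ) * g x ^ (1 / 2 : ℝ) := by
    rw [← ENNReal.mul_rpow_of_nonneg _ _ (by norm_num : (0 : ℝ) ≤ 1 / 2), one_div,
      ENNReal.le_rpow_inv_iff two_pos, ENNReal.rpow_two]
    exact hfg x
  have hCS := ENNReal.lintegral_mul_le_Lp_mul_Lq ν Real.HolderConjugate.two_two
    (hf.pow_const (1 / 2 : ℝ)) (hg.pow_const (1 / 2 : ℝ))
  simp only [sq_sqrt] at hCS
  calc (∫⁻ x, h x ∂ν) ^ 2
      ≤ ((∫⁻ x, f x ∂ν) ^ (1 / 2 : ℝ) * (∫⁻ x, g x ∂ν) ^ (1 / 2 : ℝ)) ^ 2 := by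
        gcongr
        exact (lintegral_mono hle).trans hCS
    _ = _ := by rw [mul_pow, ← ENNReal.rpow_two, ← ENNReal.rpow_two, sq_sqrt, sq_sqrt]

theorem measure_le_smul_volume_of_Ioo {ρ : Measure ℝ} {M : ℝ≥0∞} (hM : M ≠ ⊤)
    (h : ∀ x y, x < y → ρ (Set.Ioo x y) ≤ M * ENNReal.ofReal (y - x)) : ρ ≤ M • volume := by
  rcases eq_or_ne M 0 with rfl | hM0
  · have hρ : ρ = 0 := Measure.measure_univ_eq_zero.1 <| measure_null_of_locally_null _ fun x _ ↦
      ⟨Set.Ioo (x - 1) (x + 1), mem_nhdsWithin_of_mem_nhds (Ioo_mem_nhds (by simp) (by simp)),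
        by simpa using h (x - 1) (x + 1) (by linarith)⟩
    exact hρ ▸ Measure.zero_le _
  have hIoc (x y : ℝ) : ρ (Set.Ioc x y) ≤ M * ENNReal.ofReal (y - x) := by
    rcases lt_or_ge y x with hxy | hxy
    · simp [Set.Ioc_eq_empty hxy.le.not_gt]
    have hlim : Filter.Tendsto (fun z ↦ M * ENNReal.ofReal (z - x)) (nhdsWithin y (Set.Ioi y))
        (nhds (M * ENNReal.ofReal (y - x))) :=
      (ENNReal.Tendsto.const_mul (ENNReal.tendsto_ofReal
        ((continuous_sub_right x).tendsto y)) (.inr hM)).mono_left nhdsWithin_le_nhds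
    refine ge_of_tendsto hlim ?_
    filter_upwards [self_mem_nhdsWithin] with z (hz : y < z)
    exact (measure_mono (Set.Ioc_subset_Ioo_right hz)).trans (h x z (hxy.trans_lt hz))
  have houter : ρ.toOuterMeasure ≤ M • StieltjesFunction.id.outer := by
    rw [StieltjesFunction.outer, OuterMeasure.smul_ofFunction hM, OuterMeasure.le_ofFunction]
    intro s
    simp only [Pi.smul_apply, StieltjesFunction.length_eq, smul_eq_mul,
      ENNReal.mul_iInf_of_ne hM0 hM]
    exact le_iInf₂ fun x y ↦ le_iInf fun (hs : _ ⊆ Set.Ioc x y) ↦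
      (measure_mono fun z hz ↦ hs (Set.mem_sdiff_of_mem hz (not_isBot z))).trans (hIoc x y)
  rw [Real.volume_eq_stieltjes_id]
  refine Measure.le_iff.2 fun s _ ↦ (houter s).trans ?_
  rw [Measure.smul_apply, ← Measure.coe_toOuterMeasure, StieltjesFunction.measure_def]
  exact le_rfl

end Lintegral

section TimePlancherel

variable {α : Type*} [MeasurableSpace α] {ν : Measure α} {φ : α → ℝ} {a : α → ℂ} {M : ℝ≥0∞}

/-- The oscillatory integral `t ↦ ∫ e^{-itφ} a dν` with phase `φ` and amplitude `a`. -/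
def oscIntegral (ν : Measure α) (φ : α → ℝ) (a : α → ℂ) (t : ℝ) : ℂ :=
  ∫ η, Complex.exp (-Complex.I * ((t * φ η : ℝ) : ℂ)) * a η ∂ν

theorem norm_exp_neg_I_mul (r : ℝ) : ‖Complex.exp (-Complex.I * (r : ℂ))‖ = 1 := by
  simp [Complex.norm_exp]

theorem continuous_oscIntegral (hφ : Measurable φ) (ha : Integrable a ν) :
    Continuous (oscIntegral ν φ a) := by
  refine continuous_of_dominated (bound := fun η ↦ ‖a η‖) (fun t ↦ ?_) (fun t ↦ ?_) ha.norm ?_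
  · exact (Measurable.aestronglyMeasurable (by fun_prop)).mul ha.1
  · exact .of_forall fun η ↦ by rw [norm_mul, norm_exp_neg_I_mul, one_mul]
  · exact .of_forall fun η ↦ by fun_prop

theorem integral_mul_oscIntegral [SFinite ν] (hφ : Measurable φ) (ha : Integrable a ν)
    {G : ℝ → ℂ} (hG : Integrable G) :
    ∫ t, G t * oscIntegral ν φ a t = ∫ η, 𝓕 G (φ η / (2 * Real.pi)) * a η ∂ν := by
  have hint : Integrable (fun p : ℝ × α ↦
      Complex.exp (-Complex.I * ((p.1 * φ p.2 : ℝ) : ℂ)) * (G p.1 * a p.2))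
      (volume.prod ν) :=
    (hG.mul_prod ha).bdd_mul (c := 1) (Measurable.aestronglyMeasurable (by fun_prop))
      (.of_forall fun p ↦ (norm_exp_neg_I_mul _).le)
  calc ∫ t, G t * oscIntegral ν φ a t
      = ∫ t, ∫ η, Complex.exp (-Complex.I * ((t * φ η : ℝ) : ℂ)) * (G t * a η) ∂ν := by
        simp only [oscIntegral, ← integral_const_mul, mul_left_comm]
    _ = ∫ η, (∫ t : ℝ, Complex.exp (-Complex.I * ((t * φ η : ℝ) : ℂ)) * (G t * a η)) ∂ν :=
        integral_integral_swap hint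
    _ = _ := by
        refine integral_congr_ae (.of_forall fun η ↦ ?_)
        simp only [← mul_assoc, integral_mul_const, Real.fourier_real_eq_integral_exp_smul,
          smul_eq_mul]
        congr! 5
        push_cast
        field_simp

theorem lintegral_comp_div_two_pi (f : ℝ → ℝ≥0∞) :
    ∫⁻ s, f (s / (2 * Real.pi)) = ENNReal.ofReal (2 * Real.pi) * ∫⁻ s, f s := by
  have h := Real.map_volume_mul_right (inv_ne_zero Real.two_pi_pos.ne')
  rw [inv_inv, abs_of_pos Real.two_pi_pos] at h
  simp only [div_eq_mul_inv]
  rw [← smul_eq_mul (ENNReal.ofReal _), ← lintegral_smul_measure, ← h]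
  exact (lintegral_map_equiv f
    (MeasurableEquiv.mulRight₀ _ (inv_ne_zero Real.two_pi_pos.ne'))).symm

theorem lintegral_fourier_comp_sq_le (hφ : Measurable φ) (hν : ν.map φ ≤ M • volume)
    {G : ℝ → ℂ} (h1 : Integrable G) (h2 : MemLp G 2) :
    ∫⁻ η, ‖𝓕 G (φ η / (2 * Real.pi))‖ₑ ^ 2 ∂ν ≤
      ENNReal.ofReal (2 * Real.pi) * M * ∫⁻ t, ‖G t‖ₑ ^ 2 := by
  have hm : Measurable fun s ↦ ‖𝓕 G (s / (2 * Real.pi))‖ₑ ^ 2 :=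
    ((continuous_fourier h1).comp (continuous_id.div_const _)).measurable.enorm.pow_const 2
  calc ∫⁻ η, ‖𝓕 G (φ η / (2 * Real.pi))‖ₑ ^ 2 ∂ν
      = ∫⁻ s, ‖𝓕 G (s / (2 * Real.pi))‖ₑ ^ 2 ∂(ν.map φ) := (lintegral_map hm hφ).symm
    _ ≤ ∫⁻ s, ‖𝓕 G (s / (2 * Real.pi))‖ₑ ^ 2 ∂(M • volume) := lintegral_mono' hν le_rfl
    _ = _ := by
      rw [lintegral_smul_measure, lintegral_comp_div_two_pi fun s ↦ ‖𝓕 G s‖ₑ ^ 2,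
        ← eLpNorm_two_sq, eLpNorm_fourier h1 h2, eLpNorm_two_sq, smul_eq_mul]
      ring

theorem enorm_integral_mul_oscIntegral_sq_le [SFinite ν] (hφ : Measurable φ)
    (hν : ν.map φ ≤ M • volume) (ha : Integrable a ν) {G : ℝ → ℂ} (h1 : Integrable G)
    (h2 : MemLp G 2) :
    ‖∫ t, G t * oscIntegral ν φ a t‖ₑ ^ 2 ≤
      (ENNReal.ofReal (2 * Real.pi) * M * ∫⁻ η, ‖a η‖ₑ ^ 2 ∂ν) * ∫⁻ t, ‖G t‖ₑ ^ 2 := by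
  have hm : Measurable fun η ↦ 𝓕 G (φ η / (2 * Real.pi)) :=
    (continuous_fourier h1).measurable.comp (hφ.div_const _)
  rw [integral_mul_oscIntegral hφ ha h1]
  calc ‖∫ η, 𝓕 G (φ η / (2 * Real.pi)) * a η ∂ν‖ₑ ^ 2
      ≤ (∫⁻ η, ‖𝓕 G (φ η / (2 * Real.pi)) * a η‖ₑ ∂ν) ^ 2 := by
        gcongr
        exact enorm_integral_le_lintegral_enorm _
    _ ≤ (∫⁻ η, ‖𝓕 G (φ η / (2 * Real.pi))‖ₑ ^ 2 ∂ν) * ∫⁻ η, ‖a η‖ₑ ^ 2 ∂ν :=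
        sq_lintegral_le_of_sq_le_mul (hm.enorm.pow_const 2).aemeasurable
          (ha.1.enorm.pow_const 2) fun η ↦ by rw [enorm_mul, mul_pow]
    _ ≤ _ := (mul_le_mul_left (lintegral_fourier_comp_sq_le hφ hν h1 h2) _).trans_eq (by ring)

theorem lintegral_sq_le_of_forall_enorm_integral_mul_sq_le {u : ℝ → ℂ} (hu : Continuous u)
    {K : ℝ≥0∞} (h : ∀ G : ℝ → ℂ, Integrable G → MemLp G 2 →
      ‖∫ t, G t * u t‖ₑ ^ 2 ≤ K * ∫⁻ t, ‖G t‖ₑ ^ 2) :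
    ∫⁻ t, ‖u t‖ₑ ^ 2 ≤ K := by
  have htrunc (r : ℝ) : ∫⁻ t in Set.Icc (-r) r, ‖u t‖ₑ ^ 2 ≤ K := by
    let G : ℝ → ℂ := (Set.Icc (-r) r).indicator fun t ↦ star (u t)
    obtain ⟨C, hC⟩ := isCompact_Icc.exists_bound_of_continuousOn hu.star.continuousOn
    have hG (p : ℝ≥0∞) : MemLp G p := (memLp_indicator_iff_restrict measurableSet_Icc).2
      (MemLp.of_bound hu.star.aestronglyMeasurable C
        (ae_restrict_of_forall_mem measurableSet_Icc hC))
    have hsq : ∫⁻ t, ‖G t‖ₑ ^ 2 = ∫⁻ t in Set.Icc (-r) r, ‖u t‖ₑ ^ 2 := by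
      rw [← lintegral_indicator measurableSet_Icc]
      congr! with t
      by_cases ht : t ∈ Set.Icc (-r) r <;> simp [G, ht]
    have hint : ‖∫ t, G t * u t‖ₑ = ∫⁻ t in Set.Icc (-r) r, ‖u t‖ₑ ^ 2 := by
      have hGu (t : ℝ) : G t * u t = ((‖G t‖ ^ 2 : ℝ) : ℂ) := by
        by_cases ht : t ∈ Set.Icc (-r) r <;> simp [G, ht, Complex.conj_mul']
      have hnonneg : 0 ≤ᵐ[volume] fun t ↦ ‖G t‖ ^ 2 := .of_forall fun t ↦ by positivity
      simp_rw [hGu, integral_complex_ofReal]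
      rw [← ofReal_norm, Complex.norm_real, Real.norm_of_nonneg (integral_nonneg_of_ae hnonneg),
        ofReal_integral_eq_lintegral_ofReal ((hG 2).integrable_norm_pow two_ne_zero) hnonneg, ← hsq]
      simp only [ENNReal.ofReal_pow (norm_nonneg _), ofReal_norm]
    have hfin : ∫⁻ t in Set.Icc (-r) r, ‖u t‖ₑ ^ 2 ≠ ⊤ := hint ▸ enorm_ne_top
    have hle := h G (memLp_one_iff_integrable.1 (hG 1)) (hG 2)
    rw [hint, hsq, sq] at hle
    rcases eq_or_ne (∫⁻ t in Set.Icc (-r) r, ‖u t‖ₑ ^ 2) 0 with h0 | h0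
    · exact h0 ▸ zero_le
    · exact (ENNReal.mul_le_mul_iff_left h0 hfin).1 hle
  exact le_of_tendsto' ((aecover_Icc Filter.tendsto_neg_atTop_atBot
    Filter.tendsto_id).lintegral_tendsto_of_countably_generated
      (hu.measurable.enorm.pow_const 2).aemeasurable) htrunc

theorem lintegral_oscIntegral_sq_le [SFinite ν] (hφ : Measurable φ) (hν : ν.map φ ≤ M • volume)
    (ha : Integrable a ν) :
    ∫⁻ t, ‖oscIntegral ν φ a t‖ₑ ^ 2 ≤
      ENNReal.ofReal (2 * Real.pi) * M * ∫⁻ η, ‖a η‖ₑ ^ 2 ∂ν :=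
  lintegral_sq_le_of_forall_enorm_integral_mul_sq_le (continuous_oscIntegral hφ ha)
    fun _ ↦ enorm_integral_mul_oscIntegral_sq_le hφ hν ha

end TimePlancherel

section Bilinear

variable {V : Type*} [NormedAddCommGroup V] [InnerProductSpace ℝ V] [FiniteDimensional ℝ V]
  [MeasurableSpace V] [BorelSpace V]

theorem lintegral_lintegral_mul_sub {f g : V → ℝ≥0∞} (hf : AEMeasurable f) (hg : AEMeasurable g) :
    ∫⁻ ξ, ∫⁻ η, f η * g (ξ - η) = (∫⁻ η, f η) * ∫⁻ η, g η := by
  have hsub : Measure.QuasiMeasurePreserving (fun p : V × V ↦ p.1 - p.2)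
      (volume.prod volume) volume := quasiMeasurePreserving_sub_of_right_invariant volume volume
  rw [lintegral_lintegral_swap (hf.comp_snd.mul (hg.comp_quasiMeasurePreserving hsub)),
    ← lintegral_mul_const'' _ hf]
  refine lintegral_congr fun η ↦ ?_
  have hgη : AEMeasurable fun ξ ↦ g (ξ - η) := hg.comp_quasiMeasurePreserving
    (measurePreserving_sub_right volume η).quasiMeasurePreserving
  rw [lintegral_const_mul'' _ hgη, lintegral_sub_right_eq_self g η]

theorem lintegral_bilinear_oscIntegral_le {F G : V → ℂ} (hF : MemLp F 2) (hG : MemLp G 2)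
    {Φ : V → V → ℝ} (hΦ : ∀ ξ, Measurable (Φ ξ)) {A X : Set V} (hX : MeasurableSet X)
    (hFA : ∀ᵐ η, η ∉ A → F η = 0) {M : ℝ≥0∞}
    (hM : ∀ ξ ∈ X, (volume.restrict A).map (Φ ξ) ≤ M • volume) :
    ∫⁻ ξ in X, ∫⁻ t, ‖oscIntegral volume (Φ ξ) (fun η ↦ F η * G (ξ - η)) t‖ₑ ^ 2 ≤
      ENNReal.ofReal (2 * Real.pi) * M * ((∫⁻ η, ‖F η‖ₑ ^ 2) * ∫⁻ η, ‖G η‖ₑ ^ 2) := by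
  have hξ (ξ : V) (hξX : ξ ∈ X) :
      ∫⁻ t, ‖oscIntegral volume (Φ ξ) (fun η ↦ F η * G (ξ - η)) t‖ₑ ^ 2 ≤
        ∫⁻ η, ENNReal.ofReal (2 * Real.pi) * M * ‖F η‖ₑ ^ 2 * ‖G (ξ - η)‖ₑ ^ 2 := by
    have hGξ : MemLp (fun η ↦ G (ξ - η)) 2 :=
      hG.comp_measurePreserving (Measure.measurePreserving_sub_left volume ξ)
    have hrestrict : oscIntegral volume (Φ ξ) (fun η ↦ F η * G (ξ - η)) =
        oscIntegral (volume.restrict A) (Φ ξ) (fun η ↦ F η * G (ξ - η)) := by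
      refine funext fun t ↦ (setIntegral_eq_integral_of_ae_compl_eq_zero ?_).symm
      filter_upwards [hFA] with η hη hηA
      rw [hη hηA, zero_mul, mul_zero]
    have hint : Integrable fun η ↦ F η * G (ξ - η) := hF.integrable_mul hGξ
    have hmeas : AEMeasurable fun η ↦ ‖F η‖ₑ ^ 2 * ‖G (ξ - η)‖ₑ ^ 2 :=
      (hF.1.enorm.pow_const 2).mul (hGξ.1.enorm.pow_const 2)
    rw [hrestrict]
    refine (lintegral_oscIntegral_sq_le (hΦ ξ) (hM ξ hξX) hint.restrict).trans ?_
    simp_rw [mul_assoc (ENNReal.ofReal _ * M)]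
    rw [lintegral_const_mul'' _ hmeas]
    simp_rw [enorm_mul, mul_pow]
    gcongr
    exact Measure.restrict_le_self
  calc ∫⁻ ξ in X, ∫⁻ t, ‖oscIntegral volume (Φ ξ) (fun η ↦ F η * G (ξ - η)) t‖ₑ ^ 2
      ≤ ∫⁻ ξ, ∫⁻ η, ENNReal.ofReal (2 * Real.pi) * M * ‖F η‖ₑ ^ 2 * ‖G (ξ - η)‖ₑ ^ 2 :=
        (setLIntegral_mono' hX hξ).trans (setLIntegral_le_lintegral _ _)
    _ = _ := by
        rw [lintegral_lintegral_mul_sub ((hF.1.enorm.pow_const 2).const_mul _)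
          (hG.1.enorm.pow_const 2), lintegral_const_mul'' _ (hF.1.enorm.pow_const 2), mul_assoc]

end Bilinear

section StrongConvexity

variable {E : Type*} [NormedAddCommGroup E]

theorem sq_norm_sub_le_of_strongConvexOn_of_isMinOn [NormedSpace ℝ E] {Q : Set E} {κ : ℝ}
    {f : E → ℝ} (hf : StrongConvexOn Q κ f) {p q : E} (hp : p ∈ Q) (hq : q ∈ Q)
    (hmin : IsMinOn f Q p) : κ / 2 * ‖q - p‖ ^ 2 ≤ f q - f p := by
  have hθ (θ : ℝ) (h : θ ∈ Set.Ioo (0 : ℝ) 1) : (1 - θ) * (κ / 2 * ‖q - p‖ ^ 2) ≤ f q - f p := by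
    have hconv := hf.2 hq hp h.1.le (sub_nonneg.2 h.2.le) (add_sub_cancel θ 1)
    have hle : f p ≤ f (θ • q + (1 - θ) • p) :=
      hmin (hf.1 hq hp h.1.le (sub_nonneg.2 h.2.le) (add_sub_cancel θ 1))
    simp only [smul_eq_mul] at hconv
    exact le_of_mul_le_mul_left (by linarith) h.1
  have hlim : Filter.Tendsto (fun θ : ℝ ↦ (1 - θ) * (κ / 2 * ‖q - p‖ ^ 2))
      (nhdsWithin 0 (Set.Ioi 0)) (nhds (κ / 2 * ‖q - p‖ ^ 2)) :=
    (Continuous.tendsto' (by fun_prop) _ _ (by simp)).mono_left nhdsWithin_le_nhds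
  refine le_of_tendsto hlim ?_
  filter_upwards [Ioo_mem_nhdsGT zero_lt_one] using hθ

theorem ray_growth_of_strongConvexOn_of_isMinOn [NormedSpace ℝ E] {Q : Set E} {κ : ℝ}
    {f : E → ℝ} (hf : StrongConvexOn Q κ f) {p v : E} (hp : p ∈ Q) (hv : p + v ∈ Q)
    (hmin : IsMinOn f Q p) {θ : ℝ} (h0 : 0 ≤ θ) (h1 : θ ≤ 1) :
    κ / 2 * ((1 - θ ^ 2) * ‖v‖ ^ 2) ≤ f (p + v) - f (p + θ • v) := by
  have hconv := hf.2 hv hp h0 (sub_nonneg.2 h1) (add_sub_cancel θ 1)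
  have hquad := mul_le_mul_of_nonneg_left
    (sq_norm_sub_le_of_strongConvexOn_of_isMinOn hf hp hv hmin) (sub_nonneg.2 h1)
  rw [show θ • (p + v) + (1 - θ) • p = p + θ • v by module] at hconv
  simp only [add_sub_cancel_left, smul_eq_mul] at hconv hquad
  linarith

theorem le_two_mul_sub_of_le_sq_sub_sq {D L J W : ℝ} (hD : 0 ≤ D) (hW : 0 ≤ W) (hWL : W ≤ L)
    (h : D ≤ W ^ 2 - J ^ 2) : D ≤ 2 * L * (W - J) := by
  have hJW : J ≤ W := (abs_le_of_sq_le_sq' (by linarith) hW).2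
  calc D ≤ (W + J) * (W - J) := by linarith
    _ ≤ 2 * L * (W - J) := mul_le_mul_of_nonneg_right (by linarith) (by linarith)

theorem mul_sq_norm_sub_le_sqrt_mul_sqrt_sub [InnerProductSpace ℝ E] {c L : ℝ} (hc : 0 ≤ c)
    {p q : E} (hp : √(c + ‖p‖ ^ 2) ≤ L) (hq : √(c + ‖q‖ ^ 2) ≤ L) :
    c * ‖p - q‖ ^ 2 ≤
      2 * L ^ 2 * (√(c + ‖p‖ ^ 2) * √(c + ‖q‖ ^ 2) - (c + inner ℝ p q)) := by
  refine le_two_mul_sub_of_le_sq_sub_sq (by positivity) (by positivity)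
    (sq L ▸ mul_le_mul hp hq (by positivity) ((Real.sqrt_nonneg _).trans hp)) ?_
  have hcs : inner ℝ p q ^ 2 ≤ ‖p‖ ^ 2 * ‖q‖ ^ 2 := by
    rw [← mul_pow, ← sq_abs]
    exact pow_le_pow_left₀ (abs_nonneg _) (abs_real_inner_le_norm p q) 2
  rw [mul_pow, Real.sq_sqrt (by positivity), Real.sq_sqrt (by positivity), norm_sub_sq_real]
  linarith

theorem sq_combo_sqrt_sub_sq_sqrt_combo [InnerProductSpace ℝ E] {c : ℝ} (hc : 0 ≤ c) (p q : E)
    {α β : ℝ} (h : α + β = 1) :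
    (α * √(c + ‖p‖ ^ 2) + β * √(c + ‖q‖ ^ 2)) ^ 2 - √(c + ‖α • p + β • q‖ ^ 2) ^ 2 =
      2 * (α * β) * (√(c + ‖p‖ ^ 2) * √(c + ‖q‖ ^ 2) - (c + inner ℝ p q)) := by
  rw [norm_add_sq_real, inner_smul_left, inner_smul_right, norm_smul, norm_smul, mul_pow, mul_pow,
    Real.norm_eq_abs, Real.norm_eq_abs, sq_abs, sq_abs, add_sq, mul_pow, mul_pow,
    Real.sq_sqrt (by positivity), Real.sq_sqrt (by positivity), Real.sq_sqrt, conj_trivial]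
  · linear_combination c * (α + β + 1) * h
  · have := sq_nonneg ‖α • p + β • q‖
    rw [norm_add_sq_real, inner_smul_left, inner_smul_right, norm_smul, norm_smul, mul_pow,
      mul_pow, Real.norm_eq_abs, Real.norm_eq_abs, sq_abs, sq_abs] at this
    exact add_nonneg hc this

theorem strongConvexOn_sqrt_add_sq_norm_sub [InnerProductSpace ℝ E] {c L : ℝ} (hc : 0 ≤ c)
    (hL : 0 < L) {Q : Set E} (hQ : Convex ℝ Q) (w : E) (h : ∀ v ∈ Q, √(c + ‖w - v‖ ^ 2) ≤ L) :
    StrongConvexOn Q (c / L ^ 3) fun v ↦ √(c + ‖w - v‖ ^ 2) := by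
  refine ⟨hQ, fun p hp q hq α β hα hβ hαβ ↦ ?_⟩
  have hcombo : w - (α • p + β • q) = α • (w - p) + β • (w - q) := by
    rw [smul_sub, smul_sub, sub_add_sub_comm, ← add_smul, hαβ, one_smul]
  have hgap := mul_sq_norm_sub_le_sqrt_mul_sqrt_sub hc (h p hp) (h q hq)
  rw [sub_sub_sub_cancel_left, norm_sub_rev q p, ← div_le_iff₀' (by positivity)] at hgap
  have hsq : α * β * (c * ‖p - q‖ ^ 2 / L ^ 2) ≤
      (α * √(c + ‖w - p‖ ^ 2) + β * √(c + ‖w - q‖ ^ 2)) ^ 2 -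
        √(c + ‖w - (α • p + β • q)‖ ^ 2) ^ 2 := by
    rw [hcombo, sq_combo_sqrt_sub_sq_sqrt_combo hc _ _ hαβ]
    refine le_trans (le_of_eq (by field_simp))
      (mul_le_mul_of_nonneg_left hgap (by positivity : 0 ≤ 2 * (α * β)))
  have hbound : α * √(c + ‖w - p‖ ^ 2) + β * √(c + ‖w - q‖ ^ 2) ≤ L :=
    (add_le_add (mul_le_mul_of_nonneg_left (h p hp) hα)
      (mul_le_mul_of_nonneg_left (h q hq) hβ)).trans_eq (by rw [← add_mul, hαβ, one_mul])
  have hsub := le_two_mul_sub_of_le_sq_sub_sq (by positivity) (by positivity) hbound hsq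
  rw [← div_le_iff₀' (by positivity)] at hsub
  simp only [smul_eq_mul]
  calc _ ≤ _ := le_sub_comm.1 hsub
    _ = _ := by field_simp

end StrongConvexity

section LevelSets

theorem setLIntegral_ofReal_le_of_sq_sub_sq_le {P : Set ℝ} (hP : P ⊆ Set.Ioi 0) {D : ℝ} (hD : 0 ≤ D)
    (h : ∀ r ∈ P, ∀ r' ∈ P, r < r' → r' ^ 2 - r ^ 2 ≤ D) :
    ∫⁻ r in P, ENNReal.ofReal r ≤ ENNReal.ofReal (D / 2) := by
  rcases P.eq_empty_or_nonempty with rfl | hne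
  · simp
  have h0 : 0 ≤ sInf P := le_csInf hne fun r hr ↦ (hP hr).le
  have hsub : P ⊆ Set.Icc (sInf P) √(sInf P ^ 2 + D) := fun r' hr' ↦ by
    refine ⟨csInf_le ⟨0, fun r hr ↦ (hP hr).le⟩ hr', Real.le_sqrt_of_sq_le ?_⟩
    have hinf : √(r' ^ 2 - D) ≤ sInf P := le_csInf hne fun r hr ↦ by
      rw [Real.sqrt_le_left (hP hr).le]
      rcases lt_or_ge r r' with hlt | hge
      · linarith [h r hr r' hr' hlt]
      · linarith [pow_le_pow_left₀ (hP hr').le hge 2]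
    linarith [(Real.sqrt_le_left h0).1 hinf]
  have hle : sInf P ≤ √(sInf P ^ 2 + D) := Real.le_sqrt_of_sq_le (by linarith)
  refine (lintegral_mono_set hsub).trans_eq ?_
  rw [← ofReal_integral_eq_lintegral_ofReal (f := fun r ↦ r)
    continuous_id.continuousOn.integrableOn_Icc
    (ae_restrict_of_forall_mem measurableSet_Icc fun r hr ↦ h0.trans hr.1),
    integral_Icc_eq_integral_Ioc, ← intervalIntegral.integral_of_le hle, integral_id,
    Real.sq_sqrt (by positivity), add_sub_cancel_left]

theorem volume_le_of_forall_smul_mem {S : Set ℂ} (hS : MeasurableSet S) {D : ℝ} (hD : 0 ≤ D)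
    (h : ∀ z ∈ S, ∀ θ ∈ Set.Ioo (0 : ℝ) 1, θ • z ∈ S → (1 - θ ^ 2) * ‖z‖ ^ 2 ≤ D) :
    volume S ≤ ENNReal.ofReal (Real.pi * D) := by
  have hpolar : Measurable Complex.polarCoord.symm :=
    Complex.measurableEquivRealProd.symm.measurable.comp continuous_polarCoord_symm.measurable
  have hray (θ : ℝ) : ∫⁻ r in Set.Ioi (0 : ℝ),
      ENNReal.ofReal r * S.indicator 1 (Complex.polarCoord.symm (r, θ)) ≤
        ENNReal.ofReal (D / 2) := by
    let P : Set ℝ := {r | Complex.polarCoord.symm (r, θ) ∈ S}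
    have hP : MeasurableSet P := hS.preimage (hpolar.comp measurable_prodMk_right)
    have hind (r : ℝ) : ENNReal.ofReal r * S.indicator 1 (Complex.polarCoord.symm (r, θ)) =
        P.indicator (fun r ↦ ENNReal.ofReal r) r := by
      by_cases hr : r ∈ P
      · rw [Set.indicator_of_mem hr, Set.indicator_of_mem (by exact hr), Pi.one_apply, mul_one]
      · rw [Set.indicator_of_notMem hr, Set.indicator_of_notMem (by exact hr), mul_zero]
    simp_rw [hind]
    rw [lintegral_indicator hP, Measure.restrict_restrict hP]
    refine setLIntegral_ofReal_le_of_sq_sub_sq_le Set.inter_subset_right hD fun r hr r' hr' hlt ↦ ?_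
    have hr0 : 0 < r := hr.2
    have hr0' : 0 < r' := hr'.2
    have hscale : (r / r') • Complex.polarCoord.symm (r', θ) = Complex.polarCoord.symm (r, θ) := by
      simp only [Complex.polarCoord_symm_apply, Complex.real_smul, Complex.ofReal_div]
      field_simp [hr0'.ne']
    have := h _ hr'.1 (r / r') ⟨by positivity, (div_lt_one hr0').2 hlt⟩ (hscale ▸ hr.1)
    rw [Complex.norm_polarCoord_symm, sq_abs] at this
    convert this using 1
    field_simp
  rw [← lintegral_indicator_one hS, ← Complex.lintegral_comp_polarCoord_symm, polarCoord_target,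
    Measure.volume_eq_prod, ← Measure.prod_restrict]
  simp only [smul_eq_mul]
  refine (lintegral_prod_symm' _ ?_).trans_le ((lintegral_mono hray).trans_eq ?_)
  · exact Measurable.mul (by fun_prop) ((measurable_one.indicator hS).comp hpolar)
  · rw [lintegral_const, Measure.restrict_apply_univ, Real.volume_Ioo,
      ← ENNReal.ofReal_mul' (by linarith [Real.pi_pos])]
    congr 1
    ring

theorem volume_level_le_of_strongConvexOn {Q : Set ℂ} (hQ : IsCompact Q) {f : ℂ → ℝ}
    (hf : Continuous f) {κ : ℝ} (hκ : 0 < κ) (hfQ : StrongConvexOn Q κ f) {x y : ℝ}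
    (hxy : x ≤ y) :
    volume (Q ∩ f ⁻¹' Set.Ioo x y) ≤ ENNReal.ofReal (2 * Real.pi / κ * (y - x)) := by
  rcases Q.eq_empty_or_nonempty with rfl | hne
  · simp
  obtain ⟨p, hp, hmin⟩ := hQ.exists_isMinOn hne hf.continuousOn
  have hm : MeasurableSet (Q ∩ f ⁻¹' Set.Ioo x y) :=
    hQ.measurableSet.inter (measurableSet_Ioo.preimage hf.measurable)
  rw [← measure_preimage_add volume p]
  refine (volume_le_of_forall_smul_mem (D := 2 / κ * (y - x))
    (hm.preimage (measurable_const_add p)) (by positivity)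
    fun v hv θ hθ hθv ↦ ?_).trans_eq (congrArg _ (by ring))
  have hgrowth := ray_growth_of_strongConvexOn_of_isMinOn hfQ hp hv.1 hmin hθ.1.le hθ.2.le
  have hlt : f (p + v) < y := hv.2.2
  have hgt : x < f (p + θ • v) := hθv.2.1
  rw [div_mul_eq_mul_div, le_div_iff₀ hκ]
  linarith

end LevelSets

section Slices

variable {α β : Type*} [MeasurableSpace α] [MeasurableSpace β]

theorem measure_prod_le_of_forall_slice_le {μ : Measure α} {ν : Measure β} [SFinite ν]
    {T : Set (α × β)} (hT : MeasurableSet T) {A : Set α} (hTA : T ⊆ A ×ˢ Set.univ) {δ : ℝ≥0∞}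
    (h : ∀ a ∈ A, ν (Prod.mk a ⁻¹' T) ≤ δ) : μ.prod ν T ≤ δ * μ A := by
  rw [Measure.prod_apply hT]
  refine (lintegral_mono fun a ↦ ?_).trans (lintegral_indicator_const_le A δ)
  by_cases ha : a ∈ A
  · simpa only [Set.indicator_of_mem ha] using h a ha
  · have hempty : Prod.mk a ⁻¹' T = ∅ := Set.eq_empty_of_forall_notMem fun b hb ↦ ha (hTA hb).1
    simp only [hempty, measure_empty, zero_le]

theorem measure_prod_le_of_forall_slice_le_symm {μ : Measure α} {ν : Measure β} [SFinite μ]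
    [SFinite ν] {T : Set (α × β)} (hT : MeasurableSet T) {B : Set β} (hTB : T ⊆ Set.univ ×ˢ B)
    {δ : ℝ≥0∞} (h : ∀ b ∈ B, μ ((fun a ↦ (a, b)) ⁻¹' T) ≤ δ) : μ.prod ν T ≤ δ * ν B := by
  rw [← Measure.prod_swap, Measure.map_apply measurable_swap hT]
  exact measure_prod_le_of_forall_slice_le (hT.preimage measurable_swap)
    (fun p hp ↦ ⟨(hTB hp).2, trivial⟩) h

end Slices

section SumPhase

/-- The Japanese bracket `⟨ξ⟩_m` when `ℝ³` is split as `ℝ × ℂ`. -/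
def prodJap (m : ℝ) (p : ℝ × ℂ) : ℝ := √(m ^ 2 + p.1 ^ 2 + ‖p.2‖ ^ 2)

/-- The phase `⟨p⟩_m + ⟨q - p⟩_m` of the (++) interaction at output frequency `q`. -/
def sumPhase (m : ℝ) (q p : ℝ × ℂ) : ℝ := prodJap m p + prodJap m (q - p)

theorem continuous_prodJap (m : ℝ) : Continuous (prodJap m) := by
  unfold prodJap
  fun_prop

theorem continuous_sumPhase (m : ℝ) (q : ℝ × ℂ) : Continuous (sumPhase m q) :=
  (continuous_prodJap m).add ((continuous_prodJap m).comp (continuous_const.sub continuous_id))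

theorem sumPhase_neg_fst (m r s : ℝ) (w v : ℂ) :
    sumPhase m (-r, w) (-s, v) = sumPhase m (r, w) (s, v) := by
  simp only [sumPhase, prodJap, Prod.mk_sub_mk, neg_sub_neg, ← sub_sq_comm s r, neg_sq]

theorem mul_sub_le_sqrt_sub_sqrt {A l L s s' : ℝ} (hA : 0 ≤ A) (hl : 0 ≤ l) (hs : l ≤ s)
    (hss' : s ≤ s') (hL : √(A + s' ^ 2) ≤ L) :
    l * (s' - s) ≤ L * (√(A + s' ^ 2) - √(A + s ^ 2)) := by
  have hD : 2 * (l * (s' - s)) ≤ √(A + s' ^ 2) ^ 2 - √(A + s ^ 2) ^ 2 := by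
    rw [Real.sq_sqrt (by positivity), Real.sq_sqrt (by positivity)]
    calc 2 * (l * (s' - s)) = (l + l) * (s' - s) := by ring
      _ ≤ (s + s') * (s' - s) :=
        mul_le_mul_of_nonneg_right (by linarith) (sub_nonneg.2 hss')
      _ = A + s' ^ 2 - (A + s ^ 2) := by ring
  have := le_two_mul_sub_of_le_sq_sub_sq
    (by have := sub_nonneg.2 hss'; positivity) (Real.sqrt_nonneg _) hL hD
  linarith

theorem mul_sub_le_sumPhase_sub {m l L r s s' : ℝ} {v : ℂ} (hl : 0 ≤ l) (hs : l ≤ s)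
    (hss' : s ≤ s') (hr : r ≤ l) (hL : prodJap m (s', v) ≤ L) (w : ℂ) :
    l * (s' - s) ≤ L * (sumPhase m (r, w) (s', v) - sumPhase m (r, w) (s, v)) := by
  have hfst : l * (s' - s) ≤ L * (prodJap m (s', v) - prodJap m (s, v)) := by
    simp only [prodJap, add_right_comm _ (_ ^ 2) (‖v‖ ^ 2)] at hL ⊢
    exact mul_sub_le_sqrt_sub_sqrt (by positivity) hl hs hss' hL
  have hsnd : prodJap m ((r, w) - (s, v)) ≤ prodJap m ((r, w) - (s', v)) := by
    refine Real.sqrt_le_sqrt (add_le_add_left (add_le_add_right ?_ _) _)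
    simpa only [Prod.mk_sub_mk, sub_sq_comm r] using
      pow_le_pow_left₀ (sub_nonneg.2 (hr.trans hs)) (sub_le_sub_right hss' r) 2
  refine hfst.trans (mul_le_mul_of_nonneg_left ?_ ((Real.sqrt_nonneg _).trans hL))
  simp only [sumPhase]
  linarith

theorem mul_abs_sub_le_abs_sumPhase_sub {m l L : ℝ} {q : ℝ × ℂ} {I : Set ℝ} {v : ℂ} (hl : 0 ≤ l)
    (hI : (∀ s ∈ I, l ≤ s) ∨ ∀ s ∈ I, s ≤ -l) (hq : |q.1| ≤ l)
    (hL : ∀ s ∈ I, prodJap m (s, v) ≤ L) {s s' : ℝ} (hs : s ∈ I) (hs' : s' ∈ I) :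
    l * |s' - s| ≤ L * |sumPhase m q (s', v) - sumPhase m q (s, v)| := by
  wlog hss' : s ≤ s' generalizing s s'
  · rw [abs_sub_comm, abs_sub_comm (sumPhase _ _ _)]
    exact this hs' hs (le_of_not_ge hss')
  have hL0 : 0 ≤ L := (Real.sqrt_nonneg _).trans (hL s hs)
  rw [abs_of_nonneg (sub_nonneg.2 hss')]
  rcases hI with hI | hI
  · exact (mul_sub_le_sumPhase_sub hl (hI s hs) hss' (le_of_abs_le hq) (hL s' hs') q.2).trans
      (mul_le_mul_of_nonneg_left (le_abs_self _) hL0)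
  · have hLneg : prodJap m (-s, v) ≤ L := by simpa only [prodJap, neg_sq] using hL s hs
    have := mul_sub_le_sumPhase_sub hl (le_neg_of_le_neg (hI s' hs')) (neg_le_neg hss')
      ((neg_le_abs q.1).trans hq) hLneg q.2
    rw [sumPhase_neg_fst, sumPhase_neg_fst, neg_sub_neg] at this
    exact this.trans (mul_le_mul_of_nonneg_left (abs_sub_comm (sumPhase _ _ _) _ ▸ le_abs_self _)
      hL0)

theorem volume_sumPhase_level_le_of_transversal {m l L : ℝ} {q : ℝ × ℂ} {I : Set ℝ} {Q : Set ℂ}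
    (hl : 0 < l) (hIm : MeasurableSet I) (hQm : MeasurableSet Q)
    (hI : (∀ s ∈ I, l ≤ s) ∨ ∀ s ∈ I, s ≤ -l) (hq : |q.1| ≤ l)
    (hL : ∀ p ∈ I ×ˢ Q, prodJap m p ≤ L) (x y : ℝ) :
    volume (I ×ˢ Q ∩ sumPhase m q ⁻¹' Set.Ioo x y) ≤
      ENNReal.ofReal (L / l * (y - x)) * volume Q := by
  refine measure_prod_le_of_forall_slice_le_symm ((hIm.prod hQm).inter
    (measurableSet_Ioo.preimage (continuous_sumPhase m q).measurable))
    (fun p hp ↦ ⟨trivial, hp.1.2⟩) fun v hv ↦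
    (Real.volume_le_diam _).trans (Metric.ediam_le fun s hs s' hs' ↦ ?_)
  have hL0 : 0 ≤ L := (Real.sqrt_nonneg _).trans (hL _ hs.1)
  rw [edist_dist, dist_comm, Real.dist_eq]
  refine ENNReal.ofReal_le_ofReal ?_
  rw [div_mul_eq_mul_div, le_div_iff₀' hl]
  refine (mul_abs_sub_le_abs_sumPhase_sub hl.le hI hq (fun s hs ↦ hL _ ⟨hs, hv⟩) hs.1.1
    hs'.1.1).trans (mul_le_mul_of_nonneg_left ?_ hL0)
  exact abs_sub_le_iff.2 ⟨by linarith [hs.2.1, hs'.2.2], by linarith [hs.2.2, hs'.2.1]⟩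

theorem strongConvexOn_sumPhase {m l L s : ℝ} {q : ℝ × ℂ} {Q : Set ℂ} (hl : 0 ≤ l) (hs : l ≤ |s|)
    (hL : 0 < L) (hQ : IsCompact Q) (hQc : Convex ℝ Q) (h : ∀ v ∈ Q, prodJap m (s, v) ≤ L) :
    StrongConvexOn Q (l ^ 2 / L ^ 3) fun v ↦ sumPhase m q (s, v) := by
  have hfst : StrongConvexOn Q ((m ^ 2 + s ^ 2) / L ^ 3) fun v ↦ prodJap m (s, v) := by
    simpa only [prodJap, zero_sub, norm_neg] using
      strongConvexOn_sqrt_add_sq_norm_sub (by positivity) hL hQc 0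
        (by simpa only [prodJap, zero_sub, norm_neg] using h)
  have hsnd : StrongConvexOn Q 0 fun v ↦ prodJap m (q - (s, v)) := by
    obtain ⟨L', hL'⟩ := hQ.bddAbove_image (f := fun v ↦ prodJap m (q - (s, v)))
      ((continuous_prodJap m).comp (by fun_prop)).continuousOn
    exact StrongConvexOn.mono (by positivity) (strongConvexOn_sqrt_add_sq_norm_sub
      (c := m ^ 2 + (q.1 - s) ^ 2) (by positivity) (lt_max_of_lt_right one_pos) hQc q.2
      fun v hv ↦ le_max_of_le_left (b := L') (c := 1) (hL' ⟨v, hv, rfl⟩))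
  have hmono : l ^ 2 / L ^ 3 ≤ (m ^ 2 + s ^ 2) / L ^ 3 := by
    gcongr
    linarith [sq_nonneg m, sq_abs s, pow_le_pow_left₀ hl hs 2]
  exact UniformConvexOn.mono (fun r ↦ by simp) (UniformConvexOn.add (hfst.mono hmono) hsnd)

theorem volume_sumPhase_level_le_of_curved {m l L : ℝ} {q : ℝ × ℂ} {I : Set ℝ} {Q : Set ℂ}
    (hl : 0 < l) (hL : 0 < L) (hIm : MeasurableSet I) (hQ : IsCompact Q) (hQc : Convex ℝ Q)
    (hI : ∀ s ∈ I, l ≤ |s|) (h : ∀ p ∈ I ×ˢ Q, prodJap m p ≤ L) {x y : ℝ} (hxy : x ≤ y) :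
    volume (I ×ˢ Q ∩ sumPhase m q ⁻¹' Set.Ioo x y) ≤
      ENNReal.ofReal (2 * Real.pi * L ^ 3 / l ^ 2 * (y - x)) * volume I := by
  refine measure_prod_le_of_forall_slice_le ((hIm.prod hQ.measurableSet).inter
    (measurableSet_Ioo.preimage (continuous_sumPhase m q).measurable))
    (fun p hp ↦ ⟨hp.1.1, trivial⟩) fun s hs ↦ ?_
  have hslice : Prod.mk s ⁻¹' (I ×ˢ Q ∩ sumPhase m q ⁻¹' Set.Ioo x y) ⊆
      Q ∩ (fun v ↦ sumPhase m q (s, v)) ⁻¹' Set.Ioo x y := fun v hv ↦ ⟨hv.1.2, hv.2⟩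
  refine (measure_mono hslice).trans ((volume_level_le_of_strongConvexOn hQ
    ((continuous_sumPhase m q).comp (Continuous.prodMk_right s)) (by positivity)
    (strongConvexOn_sumPhase hl.le (hI s hs) hL hQ hQc fun v hv ↦ h _ ⟨hs, hv⟩) hxy).trans_eq ?_)
  rw [div_div_eq_mul_div]

end SumPhase

section Coordinates

/-- The phase of the product of two propagators at output frequency `ξ`; the factor `2π` is that of
Mathlib's Fourier transform. -/
def bracketSum (m ε : ℝ) (ξ η : R3) : ℝ :=
  jap m ((2 * Real.pi) • η) + ε * jap m ((2 * Real.pi) • (ξ - η))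

theorem measurable_bracketSum (m ε : ℝ) (ξ : R3) : Measurable (bracketSum m ε ξ) := by
  unfold bracketSum jap
  fun_prop

/-- The frequencies of size comparable to `l` in the cube `C_z`, where functions localized to both
have their Fourier transform. As in `bracketSum`, frequencies are multiplied by `2π`. -/
def shellCube (μ l : ℝ) (z : Fin 3 → ℤ) : Set R3 :=
  {η | (2 * Real.pi) • η ∈ cube μ z ∧ l / 2 ≤ ‖(2 * Real.pi) • η‖ ∧ ‖(2 * Real.pi) • η‖ ≤ 2 * l}

/-- Coordinates of `ℝ³` with the `i`-th one singled out. -/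
def coords (i : Fin 3) (ξ : R3) : ℝ × ℂ := (ξ i, ⟨ξ (i.succAbove 0), ξ (i.succAbove 1)⟩)

theorem measurePreserving_coords (i : Fin 3) : MeasurePreserving (coords i) volume volume :=
  ((MeasurePreserving.id volume).prod (Complex.volume_preserving_equiv_real_prod.symm.comp
    (volume_preserving_finTwoArrow ℝ))).comp
    ((volume_preserving_piFinSuccAbove (fun _ : Fin 3 ↦ ℝ) i).comp
      (PiLp.volume_preserving_ofLp (Fin 3)))

theorem jap_eq_prodJap (m : ℝ) (i : Fin 3) (ξ : R3) : jap m ξ = prodJap m (coords i ξ) := by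
  rw [jap, prodJap, EuclideanSpace.real_norm_sq_eq, Fin.sum_univ_succAbove _ i, Fin.sum_univ_two,
    Complex.sq_norm, Complex.normSq_mk, ← sq, ← sq, add_assoc]
  rfl

theorem bracketSum_one_eq_sumPhase (m : ℝ) (i : Fin 3) (ξ η : R3) :
    bracketSum m 1 ξ η =
      sumPhase m (coords i ((2 * Real.pi) • ξ)) (coords i ((2 * Real.pi) • η)) := by
  rw [bracketSum, one_mul, smul_sub, jap_eq_prodJap m i, jap_eq_prodJap m i]
  rfl

/-- The side `[μ n, μ n + μ]` of a closed cube. -/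
def side (μ : ℝ) (n : ℤ) : Set ℝ := Set.Icc (μ * n) (μ * n + μ)

/-- The face of the closed cube at `μ z` orthogonal to the `i`-th coordinate. -/
def face (μ : ℝ) (z : Fin 3 → ℤ) (i : Fin 3) : Set ℂ :=
  side μ (z (i.succAbove 0)) ×ℂ side μ (z (i.succAbove 1))

theorem coords_mem_of_mem_cube {μ : ℝ} {z : Fin 3 → ℤ} {η : R3} (hη : η ∈ cube μ z) (i : Fin 3) :
    coords i η ∈ side μ (z i) ×ˢ face μ z i :=
  have hside (j : Fin 3) : η j ∈ side μ (z j) := ⟨(hη j).1, (hη j).2.le⟩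
  ⟨hside i, hside _, hside _⟩

theorem measurableSet_side (μ : ℝ) (n : ℤ) : MeasurableSet (side μ n) := measurableSet_Icc

theorem volume_side (μ : ℝ) (n : ℤ) : volume (side μ n) = ENNReal.ofReal μ := by
  rw [side, Real.volume_Icc, add_sub_cancel_left]

theorem isCompact_face (μ : ℝ) (z : Fin 3 → ℤ) (i : Fin 3) : IsCompact (face μ z i) :=
  isCompact_Icc.reProdIm isCompact_Icc

theorem convex_face (μ : ℝ) (z : Fin 3 → ℤ) (i : Fin 3) : Convex ℝ (face μ z i) :=
  ((convex_Icc _ _).linear_preimage Complex.reLm).inter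
    ((convex_Icc _ _).linear_preimage Complex.imLm)

theorem volume_face {μ : ℝ} (hμ : 0 ≤ μ) (z : Fin 3 → ℤ) (i : Fin 3) :
    volume (face μ z i) = ENNReal.ofReal (μ ^ 2) := by
  have hpre : face μ z i = Complex.measurableEquivRealProd ⁻¹'
      (side μ (z (i.succAbove 0)) ×ˢ side μ (z (i.succAbove 1))) := rfl
  rw [hpre, Complex.volume_preserving_equiv_real_prod.measure_preimage_equiv,
    Measure.volume_eq_prod, Measure.prod_prod, volume_side, volume_side, ← ENNReal.ofReal_mul hμ,
    sq]

theorem exists_dominant_side {μ l : ℝ} {z : Fin 3 → ℤ} (hμl : 20 * μ ≤ l) (hl : 0 < l)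
    (hne : (shellCube μ l z).Nonempty) :
    ∃ i, (∀ s ∈ side μ (z i), l / 8 ≤ s) ∨ ∀ s ∈ side μ (z i), s ≤ -(l / 8) := by
  obtain ⟨η, hη, hlow, -⟩ := hne
  have hbig : ∃ i, l / 4 ≤ |((2 * Real.pi) • η) i| := by
    by_contra! h
    have hsq (i : Fin 3) : ((2 * Real.pi) • η) i ^ 2 ≤ (l / 4) ^ 2 :=
      sq_le_sq.2 ((h i).le.trans (le_abs_self _))
    have hnorm := EuclideanSpace.real_norm_sq_eq ((2 * Real.pi) • η)
    rw [Fin.sum_univ_three] at hnorm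
    linarith [pow_le_pow_left₀ (by positivity) hlow 2, hsq 0, hsq 1, hsq 2, sq_pos_of_pos hl]
  refine hbig.imp fun i hi ↦ ?_
  have hηi := hη i
  refine (le_abs.1 hi).imp (fun h s hs ↦ ?_) fun h s hs ↦ ?_
  · linarith [hs.1]
  · linarith [hs.2]

theorem prodJap_le_of_shellCube_nonempty (m : ℝ) {μ l : ℝ} {z : Fin 3 → ℤ} (hμl : 20 * μ ≤ l)
    (hl : 1 ≤ l) (hne : (shellCube μ l z).Nonempty) {i : Fin 3} {p : ℝ × ℂ}
    (hp : p ∈ side μ (z i) ×ˢ face μ z i) : prodJap m p ≤ (|m| + 6) * l := by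
  obtain ⟨η, hη, -, hup⟩ := hne
  have hside (j : Fin 3) {s : ℝ} (hs : s ∈ side μ (z j)) : s ^ 2 ≤ (3 * l) ^ 2 := by
    have hηj := abs_le.1 ((PiLp.norm_apply_le ((2 * Real.pi) • η) j).trans hup)
    have hz := hη j
    exact sq_le_sq' (by linarith [hs.1]) (by linarith [hs.2])
  have hm : m ^ 2 ≤ m ^ 2 * l ^ 2 := le_mul_of_one_le_right (sq_nonneg m) (one_le_pow₀ hl)
  refine Real.sqrt_le_iff.2 ⟨by positivity, ?_⟩
  rw [Complex.sq_norm, Complex.normSq_apply, ← sq, ← sq]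
  calc m ^ 2 + p.1 ^ 2 + (p.2.re ^ 2 + p.2.im ^ 2)
      ≤ m ^ 2 * l ^ 2 + 27 * l ^ 2 := by
        linarith [hside i hp.1, hside _ hp.2.1, hside _ hp.2.2]
    _ ≤ |m| ^ 2 * l ^ 2 + 27 * l ^ 2 + (12 * |m| + 9) * l ^ 2 := by
        rw [sq_abs]
        exact le_add_of_nonneg_right (by positivity)
    _ = ((|m| + 6) * l) ^ 2 := by ring

theorem volume_preimage_two_pi_smul_le (S : Set R3) :
    volume ((fun η : R3 ↦ (2 * Real.pi) • η) ⁻¹' S) ≤ volume S := by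
  rw [Measure.addHaar_preimage_smul _ (by positivity : (2 * Real.pi) ≠ 0)]
  refine mul_le_of_le_one_left zero_le ?_
  rw [ENNReal.ofReal_le_one, finrank_euclideanSpace_fin, abs_of_pos (by positivity)]
  exact inv_le_one_of_one_le₀ (one_le_pow₀ (by linarith [Real.pi_gt_three]))

theorem map_bracketSum_le {m μ l : ℝ} {z : Fin 3 → ℤ} {ξ : R3} {M : ℝ≥0∞} (hM : M ≠ ⊤)
    (i : Fin 3) (h : ∀ x y, x < y → volume (side μ (z i) ×ˢ face μ z i ∩
      sumPhase m (coords i ((2 * Real.pi) • ξ)) ⁻¹' Set.Ioo x y) ≤ M * ENNReal.ofReal (y - x)) :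
    (volume.restrict (shellCube μ l z)).map (bracketSum m 1 ξ) ≤ M • volume := by
  refine measure_le_smul_volume_of_Ioo hM fun x y hxy ↦ le_trans ?_ (h x y hxy)
  have hmeas : MeasurableSet (side μ (z i) ×ˢ face μ z i ∩
      sumPhase m (coords i ((2 * Real.pi) • ξ)) ⁻¹' Set.Ioo x y) :=
    ((measurableSet_side μ _).prod (isCompact_face μ z i).measurableSet).inter
      (measurableSet_Ioo.preimage (continuous_sumPhase m _).measurable)
  have hlevel := measurableSet_Ioo (a := x) (b := y).preimage (measurable_bracketSum m 1 ξ)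
  rw [Measure.map_apply (measurable_bracketSum m 1 ξ) measurableSet_Ioo,
    Measure.restrict_apply hlevel,
    ← (measurePreserving_coords i).measure_preimage hmeas.nullMeasurableSet]
  refine le_trans (measure_mono fun η hη ↦ ?_) (volume_preimage_two_pi_smul_le _)
  refine ⟨coords_mem_of_mem_cube hη.2.1 i, ?_⟩
  simpa only [Set.mem_preimage, bracketSum_one_eq_sumPhase m i] using hη.1

theorem map_bracketSum_le_of_norm_le (m : ℝ) {μ l : ℝ} (z : Fin 3 → ℤ) (hμ : 0 < μ)
    (hμl : 20 * μ ≤ l) (hl : 1 ≤ l) {ξ : R3} (hξ : ‖(2 * Real.pi) • ξ‖ ≤ 2 * μ) :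
    (volume.restrict (shellCube μ l z)).map (bracketSum m 1 ξ) ≤
      ENNReal.ofReal (8 * (|m| + 6) * μ ^ 2) • volume := by
  rcases (shellCube μ l z).eq_empty_or_nonempty with hempty | hne
  · rw [hempty, Measure.restrict_empty, Measure.map_zero]
    exact Measure.zero_le _
  obtain ⟨i, hi⟩ := exists_dominant_side hμl (by linarith) hne
  refine map_bracketSum_le ENNReal.ofReal_ne_top i fun x y _ ↦ ?_
  have hq : |(coords i ((2 * Real.pi) • ξ)).1| ≤ l / 8 :=
    (PiLp.norm_apply_le ((2 * Real.pi) • ξ) i).trans (by linarith)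
  refine (volume_sumPhase_level_le_of_transversal (by positivity) (measurableSet_side μ _)
    (isCompact_face μ z i).measurableSet hi hq
    (fun p hp ↦ prodJap_le_of_shellCube_nonempty m hμl hl hne hp) x y).trans_eq ?_
  rw [volume_face hμ.le, ← ENNReal.ofReal_mul' (by positivity),
    ← ENNReal.ofReal_mul (by positivity)]
  congr 1
  field_simp

theorem map_bracketSum_le_mul (m : ℝ) {μ l : ℝ} (z : Fin 3 → ℤ) (hμ : 0 < μ) (hμl : 20 * μ ≤ l)
    (hl : 1 ≤ l) (ξ : R3) :
    (volume.restrict (shellCube μ l z)).map (bracketSum m 1 ξ) ≤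
      ENNReal.ofReal (128 * Real.pi * (|m| + 6) ^ 3 * (μ * l)) • volume := by
  rcases (shellCube μ l z).eq_empty_or_nonempty with hempty | hne
  · rw [hempty, Measure.restrict_empty, Measure.map_zero]
    exact Measure.zero_le _
  obtain ⟨i, hi⟩ := exists_dominant_side hμl (by linarith) hne
  have habs (s : ℝ) (hs : s ∈ side μ (z i)) : l / 8 ≤ |s| :=
    le_abs'.2 (hi.symm.imp (fun h ↦ h s hs) fun h ↦ h s hs)
  refine map_bracketSum_le ENNReal.ofReal_ne_top i fun x y hxy ↦ ?_
  refine (volume_sumPhase_level_le_of_curved (by positivity) (by positivity)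
    (measurableSet_side μ _) (isCompact_face μ z i) (convex_face μ z i) habs
    (fun p hp ↦ prodJap_le_of_shellCube_nonempty m hμl hl hne hp) hxy.le).trans_eq ?_
  rw [volume_side, ← ENNReal.ofReal_mul' hμ.le, ← ENNReal.ofReal_mul (by positivity)]
  congr 1
  field_simp
  ring

end Coordinates

section Multipliers

theorem coeFn_fourier_multiplier {σ : R3 → ℂ} (hσ : Measurable σ) (hb : ∃ C, ∀ ξ, ‖σ ξ‖ ≤ C)
    (f : L2) : (𝓕 (multiplier σ hσ hb f) : L2) =ᵐ[volume]
      fun ξ ↦ σ ((2 * Real.pi) • ξ) * (𝓕 f : L2) ξ := by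
  rw [multiplier, FourierTransform.fourier_fourierInv_eq]
  exact MemLp.coeFn_toLp _

theorem Cutoff.eq_zero (χ : Cutoff) {s : ℝ} (hs : 2 ≤ |s|) : χ.toFun s = 0 := by
  by_contra h
  have hsupp := χ.support (subset_tsupport _ h)
  exact hs.not_gt (abs_lt.2 hsupp)

theorem rho_eq_zero_of_le (χ : Cutoff) {l s : ℝ} (hs : 2 * l ≤ |s|) : rho χ l s = 0 := by
  unfold rho
  split_ifs with hl hl1
  · rfl
  · exact χ.eq_zero (by linarith)
  · have hl0 : 0 < l := by linarith
    rw [χ.eq_zero, χ.eq_zero, sub_zero]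
    · rw [abs_div, abs_of_pos hl0, le_div_iff₀ hl0, abs_mul, abs_two]
      linarith
    · rwa [abs_div, abs_of_pos hl0, le_div_iff₀ hl0]

theorem rho_eq_zero_of_le_half (χ : Cutoff) {l s : ℝ} (hl : 1 < l) (hs : |s| ≤ l / 2) :
    rho χ l s = 0 := by
  have hl0 : 0 < l := by linarith
  rw [rho, if_neg hl.not_gt, if_neg hl.ne', χ.eq_one, χ.eq_one, sub_self]
  · rw [abs_div, abs_of_pos hl0, div_le_one hl0, abs_mul, abs_two]
    linarith
  · rw [abs_div, abs_of_pos hl0, div_le_one hl0]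
    linarith

theorem Cutoff.exists_rho_bound (χ : Cutoff) : ∃ R, 0 < R ∧ ∀ l s, |rho χ l s| ≤ R := by
  obtain ⟨C, hC⟩ := χ.exists_bound
  have hC1 : 1 ≤ C := by simpa [χ.eq_one 0] using hC 0
  refine ⟨C + C, by positivity, fun l s ↦ ?_⟩
  unfold rho
  split_ifs
  · rw [abs_zero]
    positivity
  · linarith [hC s]
  · exact (abs_sub _ _).trans (add_le_add (hC _) (hC _))

theorem fourier_localized_eq_zero_of_le (χ : Cutoff) (μ l : ℝ) (z : Fin 3 → ℤ) (f : L2) :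
    ∀ᵐ ξ : R3, 2 * l ≤ ‖(2 * Real.pi) • ξ‖ → (𝓕 (localized χ μ l z f) : L2) ξ = 0 := by
  filter_upwards [coeFn_fourier_multiplier _ _ (freqProj χ l f),
    coeFn_fourier_multiplier (measurable_rho_symbol χ l) (bound_rho_symbol χ l) f]
    with ξ hcube hfreq hξ
  rw [localized, cubeProj, hcube, freqProj, hfreq, rho_eq_zero_of_le χ (by rwa [abs_norm]),
    Complex.ofReal_zero, zero_mul, mul_zero]

theorem fourier_localized_eq_zero_of_notMem_shellCube (χ : Cutoff) (μ : ℝ) {l : ℝ} (hl : 1 < l)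
    (z : Fin 3 → ℤ) (f : L2) :
    ∀ᵐ ξ : R3, ξ ∉ shellCube μ l z → (𝓕 (localized χ μ l z f) : L2) ξ = 0 := by
  filter_upwards [coeFn_fourier_multiplier _ _ (freqProj χ l f),
    coeFn_fourier_multiplier (measurable_rho_symbol χ l) (bound_rho_symbol χ l) f]
    with ξ hcube hfreq hξ
  rw [localized, cubeProj, hcube]
  by_cases hmem : (2 * Real.pi) • ξ ∈ cube μ z
  · have hrho : rho χ l ‖(2 * Real.pi) • ξ‖ = 0 := by
      by_contra hne
      refine hξ ⟨hmem, ?_, ?_⟩ <;> by_contra! hlt <;> refine hne ?_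
      · exact rho_eq_zero_of_le_half χ hl (by rw [abs_norm]; exact hlt.le)
      · exact rho_eq_zero_of_le χ (by rw [abs_norm]; exact hlt.le)
    rw [freqProj, hfreq, hrho, Complex.ofReal_zero, zero_mul, mul_zero]
  · rw [Set.indicator_of_notMem hmem, zero_mul]

theorem memLp_of_ae_eq_zero_off_ball {F : R3 → ℂ} {p q : ℝ≥0∞} {R : ℝ} (hF : MemLp F q)
    (hpq : p ≤ q) (h : ∀ᵐ ξ : R3, R ≤ ‖(2 * Real.pi) • ξ‖ → F ξ = 0) : MemLp F p := by
  let s : Set R3 := (fun ξ : R3 ↦ (2 * Real.pi) • ξ) ⁻¹' Metric.ball 0 R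
  have hs : MeasurableSet s := measurableSet_ball.preimage (measurable_const_smul _)
  have hind : s.indicator F =ᵐ[volume] F := by
    filter_upwards [h] with ξ hξ
    refine Set.indicator_apply_eq_self.2 fun hns ↦ hξ ?_
    simpa only [s, Set.mem_preimage, mem_ball_zero_iff, not_lt] using hns
  have hvol : volume s ≠ ⊤ :=
    ((volume_preimage_two_pi_smul_le _).trans_lt measure_ball_lt_top).ne
  exact (memLp_congr_ae hind).1 ((hF.indicator hs).mono_exponent_of_measure_support_ne_top
    (fun _ hξ ↦ Set.indicator_of_notMem hξ F) hvol hpq)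

theorem integrable_fourier_localized (χ : Cutoff) (μ l : ℝ) (z : Fin 3 → ℤ) (f : L2) :
    Integrable (𝓕 (localized χ μ l z f) : L2) :=
  memLp_one_iff_integrable.1 (memLp_of_ae_eq_zero_off_ball (Lp.memLp _) one_le_two
    (fourier_localized_eq_zero_of_le χ μ l z f))

end Multipliers

section Interaction

/-- The spatial Fourier transform of `S_m(t) a · S_m(ε t) b`. -/
def productFourier (m ε : ℝ) (a b : L2) (t : ℝ) (ξ : R3) : ℂ :=
  oscIntegral volume (bracketSum m ε ξ) (fun η ↦ (𝓕 a : L2) η * (𝓕 b : L2) (ξ - η)) t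

/-- The spatial Fourier transform of the interaction `P_μ (S_m(t) a · S_m(ε t) b)`. -/
def interactionFourier (χ : Cutoff) (m μ ε : ℝ) (a b : L2) (t : ℝ) (ξ : R3) : ℂ :=
  ((rho χ μ ‖(2 * Real.pi) • ξ‖ : ℝ) : ℂ) * productFourier m ε a b t ξ

theorem coeFn_fourier_propagator (m t : ℝ) (a : L2) :
    (𝓕 (propagator m t a) : L2) =ᵐ[volume] fun ξ ↦
      Complex.exp (-Complex.I * ((t * jap m ((2 * Real.pi) • ξ) : ℝ) : ℂ)) * (𝓕 a : L2) ξ :=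
  coeFn_fourier_multiplier _ _ a

theorem fourier_propagator_mul (m ε : ℝ) (a b : L2) (t : ℝ) :
    𝓕 (fun x ↦ propagator m t a x * propagator m (ε * t) b x) = productFourier m ε a b t := by
  ext ξ
  rw [fourier_mul_eq_convolution, productFourier, oscIntegral]
  refine integral_congr_ae ?_
  filter_upwards [coeFn_fourier_propagator m t a,
    (Measure.measurePreserving_sub_left volume ξ).quasiMeasurePreserving.ae_eq_comp
      (coeFn_fourier_propagator m (ε * t) b)] with η ha hb
  simp only [Function.comp_apply] at hb
  rw [ha, hb, mul_mul_mul_comm, ← Complex.exp_add, ← mul_add, ← Complex.ofReal_add, bracketSum]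
  ring_nf

theorem interaction_eq_fourierInv (χ : Cutoff) (m μ ε : ℝ) (a b : L2) (t : ℝ) (x : R3) :
    interaction χ m μ ε a b (t, x) = 𝓕⁻ (interactionFourier χ m μ ε a b t) x := by
  rw [interaction, freqProjL1, fourier_propagator_mul]
  rfl

theorem stronglyMeasurable_productFourier (m ε : ℝ) (a b : L2) :
    StronglyMeasurable (Function.uncurry (productFourier m ε a b)) := by
  have ha : Measurable (𝓕 a : L2) := (Lp.stronglyMeasurable _).measurable
  have hb : Measurable (𝓕 b : L2) := (Lp.stronglyMeasurable _).measurable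
  have h : Measurable fun q : (ℝ × R3) × R3 ↦
      Complex.exp (-Complex.I * ((q.1.1 * bracketSum m ε q.1.2 q.2 : ℝ) : ℂ)) *
        ((𝓕 a : L2) q.2 * (𝓕 b : L2) (q.1.2 - q.2)) := by
    unfold bracketSum jap
    fun_prop
  exact h.stronglyMeasurable.integral_prod_right'

theorem measurable_interactionFourier (χ : Cutoff) (m μ ε : ℝ) (a b : L2) :
    Measurable (Function.uncurry (interactionFourier χ m μ ε a b)) :=
  (((measurable_rho_symbol χ μ).comp (measurable_const_smul (2 * Real.pi))).comp
    measurable_snd).mul (stronglyMeasurable_productFourier m ε a b).measurable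

theorem stronglyMeasurable_interaction (χ : Cutoff) (m μ ε : ℝ) (a b : L2) :
    StronglyMeasurable (interaction χ m μ ε a b) := by
  have hexp : Measurable fun q : (ℝ × R3) × R3 ↦
      Complex.exp ((2 * Real.pi * inner ℝ q.2 q.1.2 : ℝ) * Complex.I) := by fun_prop
  have h := hexp.smul ((measurable_interactionFourier χ m μ ε a b).comp
    ((measurable_fst.comp measurable_fst).prodMk measurable_snd))
  convert h.stronglyMeasurable.integral_prod_right' (ν := volume) with p
  rw [interaction_eq_fourierInv, Real.fourierInv_eq']
  rfl

theorem norm_productFourier_le (m ε : ℝ) (a b : L2) (t : ℝ) (ξ : R3) :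
    ‖productFourier m ε a b t ξ‖ ≤ ∫ x, ‖propagator m t a x * propagator m (ε * t) b x‖ := by
  rw [← fourier_propagator_mul]
  exact VectorFourier.norm_fourierIntegral_le_integral_norm _ _ _ _ _

theorem interactionFourier_eq_zero_of_le (χ : Cutoff) (m ε : ℝ) {μ : ℝ} (a b : L2) (t : ℝ)
    {ξ : R3} (hξ : 2 * μ ≤ ‖(2 * Real.pi) • ξ‖) : interactionFourier χ m μ ε a b t ξ = 0 := by
  rw [interactionFourier, rho_eq_zero_of_le χ (by rwa [abs_norm]), Complex.ofReal_zero, zero_mul]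

theorem memLp_interactionFourier (χ : Cutoff) (m μ ε : ℝ) (a b : L2) (t : ℝ) (p : ℝ≥0∞) :
    MemLp (interactionFourier χ m μ ε a b t) p := by
  obtain ⟨R, hR0, hR⟩ := χ.exists_rho_bound
  have htop : MemLp (interactionFourier χ m μ ε a b t) ⊤ := by
    refine memLp_top_of_bound
      (measurable_interactionFourier χ m μ ε a b).of_uncurry_left.aestronglyMeasurable
      (R * ∫ x, ‖propagator m t a x * propagator m (ε * t) b x‖) (.of_forall fun ξ ↦ ?_)
    rw [interactionFourier, norm_mul, Complex.norm_real, Real.norm_eq_abs]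
    exact mul_le_mul (hR _ _) (norm_productFourier_le m ε a b t ξ) (norm_nonneg _) hR0.le
  exact memLp_of_ae_eq_zero_off_ball htop le_top
    (.of_forall fun ξ ↦ interactionFourier_eq_zero_of_le χ m ε a b t)

theorem eLpNorm_interaction_sq (χ : Cutoff) (m μ ε : ℝ) (a b : L2) :
    eLpNorm (interaction χ m μ ε a b) 2 volume ^ 2 =
      ∫⁻ t : ℝ, ∫⁻ ξ : R3, ‖interactionFourier χ m μ ε a b t ξ‖ₑ ^ 2 := by
  rw [eLpNorm_two_sq, Measure.volume_eq_prod, lintegral_prod _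
    ((stronglyMeasurable_interaction χ m μ ε a b).measurable.enorm.pow_const 2).aemeasurable]
  refine lintegral_congr fun t ↦ ?_
  simp_rw [interaction_eq_fourierInv]
  rw [← eLpNorm_two_sq, ← eLpNorm_two_sq, eLpNorm_fourierInv
    (memLp_one_iff_integrable.1 (memLp_interactionFourier χ m μ ε a b t 1))
    (memLp_interactionFourier χ m μ ε a b t 2)]

theorem lintegral_enorm_fourier_sq (a : L2) : ∫⁻ η, ‖(𝓕 a : L2) η‖ₑ ^ 2 = ‖a‖ₑ ^ 2 := by
  rw [← eLpNorm_two_sq, ← Lp.enorm_def, ← ofReal_norm, Lp.norm_fourier_eq, ofReal_norm]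

/-- The interaction is square integrable in space-time, with norm at most `B ‖a‖ ‖b‖`. -/
def InteractionBound (χ : Cutoff) (m μ ε : ℝ) (a b : L2) (B : ℝ) : Prop :=
  MemLp (interaction χ m μ ε a b) 2 volume ∧
    eLpNorm (interaction χ m μ ε a b) 2 volume ≤ ENNReal.ofReal (B * ‖a‖ * ‖b‖)

theorem InteractionBound.mono {χ : Cutoff} {m μ ε B B' : ℝ} {a b : L2}
    (h : InteractionBound χ m μ ε a b B) (hB : B ≤ B') : InteractionBound χ m μ ε a b B' :=
  ⟨h.1, h.2.trans (by gcongr)⟩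

theorem interactionBound_of_lintegral_le {χ : Cutoff} {m μ ε B : ℝ} {a b : L2} (hB : 0 ≤ B)
    (h : ∫⁻ t : ℝ, ∫⁻ ξ : R3, ‖interactionFourier χ m μ ε a b t ξ‖ₑ ^ 2 ≤
      ENNReal.ofReal (B ^ 2) * (‖a‖ₑ ^ 2 * ‖b‖ₑ ^ 2)) : InteractionBound χ m μ ε a b B := by
  have hle : eLpNorm (interaction χ m μ ε a b) 2 volume ≤ ENNReal.ofReal (B * ‖a‖ * ‖b‖) := by
    rw [← eLpNorm_interaction_sq] at h
    refine (ENNReal.pow_le_pow_left_iff two_ne_zero).1 (h.trans_eq ?_)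
    rw [ENNReal.ofReal_mul (by positivity), ENNReal.ofReal_mul hB, ofReal_norm, ofReal_norm,
      mul_pow, mul_pow, ENNReal.ofReal_pow hB, mul_assoc]
  exact ⟨⟨(stronglyMeasurable_interaction χ m μ ε a b).aestronglyMeasurable,
    hle.trans_lt ENNReal.ofReal_lt_top⟩, hle⟩

theorem interactionBound_of_fourier_eq_zero {χ : Cutoff} {m μ ε B : ℝ} {a b : L2} (hB : 0 ≤ B)
    (h : ∀ t ξ, interactionFourier χ m μ ε a b t ξ = 0) : InteractionBound χ m μ ε a b B :=
  interactionBound_of_lintegral_le hB (by simp [h])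

end Interaction

section Vanishing

theorem interactionFourier_eq_zero_of_lt_one (χ : Cutoff) (m ε : ℝ) {μ : ℝ} (hμ : μ < 1)
    (a b : L2) (t : ℝ) (ξ : R3) : interactionFourier χ m μ ε a b t ξ = 0 := by
  rw [interactionFourier, rho, if_pos hμ, Complex.ofReal_zero, zero_mul]

theorem interactionFourier_eq_zero_of_separated (χ : Cutoff) (m ε : ℝ) {μ : ℝ} {a b : L2}
    {A B : Set R3} (ha : ∀ᵐ η, η ∉ A → (𝓕 a : L2) η = 0) (hb : ∀ᵐ ζ, ζ ∉ B → (𝓕 b : L2) ζ = 0)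
    (hAB : ∀ η ∈ A, ∀ ζ ∈ B, 2 * μ ≤ ‖(2 * Real.pi) • (η + ζ)‖) (t : ℝ) (ξ : R3) :
    interactionFourier χ m μ ε a b t ξ = 0 := by
  rcases le_or_gt (2 * μ) ‖(2 * Real.pi) • ξ‖ with hξ | hξ
  · exact interactionFourier_eq_zero_of_le χ m ε a b t hξ
  have hprod : productFourier m ε a b t ξ = 0 := by
    refine integral_eq_zero_of_ae ?_
    filter_upwards [ha, (Measure.measurePreserving_sub_left volume ξ).quasiMeasurePreserving.ae hb]
      with η hη hζ
    have hor : η ∉ A ∨ ξ - η ∉ B := by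
      by_contra! hmem
      have hle := hAB η hmem.1 _ hmem.2
      rw [add_sub_cancel] at hle
      exact hξ.not_ge hle
    rcases hor with h | h
    · rw [hη h, zero_mul, mul_zero, Pi.zero_apply]
    · rw [hζ h, mul_zero, mul_zero, Pi.zero_apply]
  rw [interactionFourier, hprod, mul_zero]

theorem sub_le_norm_two_pi_smul_add (η ζ : R3) :
    ‖(2 * Real.pi) • η‖ - ‖(2 * Real.pi) • ζ‖ ≤ ‖(2 * Real.pi) • (η + ζ)‖ := by
  rw [smul_add]
  exact norm_sub_le_norm_add _ _

theorem interactionFourier_eq_zero_of_lt_mul (χ : Cutoff) (m ε : ℝ) {μ l₁ l₂ : ℝ} (hl₁ : 1 < l₁)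
    (hμl₁ : 100 * μ ≤ l₁) (hl₂ : l₂ < 20 * μ) (z z' : Fin 3 → ℤ) (f g : L2) (t : ℝ) (ξ : R3) :
    interactionFourier χ m μ ε (localized χ μ l₁ z f) (localized χ μ l₂ z' g) t ξ = 0 := by
  refine interactionFourier_eq_zero_of_separated χ m ε (B := {ζ | ‖(2 * Real.pi) • ζ‖ < 2 * l₂})
    (fourier_localized_eq_zero_of_notMem_shellCube χ μ hl₁ z f) ?_ (fun η hη ζ hζ ↦ ?_) t ξ
  · simpa only [Set.mem_ofPred_eq, not_lt] using fourier_localized_eq_zero_of_le χ μ l₂ z' g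
  · have hζ' : ‖(2 * Real.pi) • ζ‖ < 2 * l₂ := hζ
    linarith [hη.2.1, sub_le_norm_two_pi_smul_add η ζ, norm_nonneg ((2 * Real.pi) • ζ)]

theorem interactionFourier_eq_zero_of_mul_lt (χ : Cutoff) (m ε : ℝ) {μ l₁ l₂ : ℝ} (hl₁ : 1 < l₁)
    (hμl₁ : 100 * μ ≤ l₁) (hl₂ : 5 * l₁ < l₂) (z z' : Fin 3 → ℤ) (f g : L2) (t : ℝ) (ξ : R3) :
    interactionFourier χ m μ ε (localized χ μ l₁ z f) (localized χ μ l₂ z' g) t ξ = 0 := by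
  refine interactionFourier_eq_zero_of_separated χ m ε
    (fourier_localized_eq_zero_of_notMem_shellCube χ μ hl₁ z f)
    (fourier_localized_eq_zero_of_notMem_shellCube χ μ (by linarith) z' g)
    (fun η hη ζ hζ ↦ ?_) t ξ
  rw [add_comm]
  linarith [hη.2.2, hζ.2.1, sub_le_norm_two_pi_smul_add ζ η]

end Vanishing

section Estimates

variable {χ : Cutoff} {R : ℝ}

theorem enorm_interactionFourier_sq_le (hR : ∀ l s, |rho χ l s| ≤ R) (m μ ε : ℝ) (a b : L2)
    (t : ℝ) (ξ : R3) : ‖interactionFourier χ m μ ε a b t ξ‖ₑ ^ 2 ≤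
      ENNReal.ofReal (R ^ 2) * ‖productFourier m ε a b t ξ‖ₑ ^ 2 := by
  rw [interactionFourier, enorm_mul, mul_pow, ENNReal.ofReal_pow ((abs_nonneg _).trans (hR 0 0)),
    ← ofReal_norm (rho χ μ _ : ℂ), Complex.norm_real, Real.norm_eq_abs]
  gcongr
  exact hR _ _

theorem lintegral_interactionFourier_le (hR : ∀ l s, |rho χ l s| ≤ R) (m μ ε : ℝ) (a b : L2)
    (t : ℝ) : ∫⁻ ξ : R3, ‖interactionFourier χ m μ ε a b t ξ‖ₑ ^ 2 ≤ ENNReal.ofReal (R ^ 2) *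
      ∫⁻ ξ in {ξ : R3 | ‖(2 * Real.pi) • ξ‖ ≤ 2 * μ}, ‖productFourier m ε a b t ξ‖ₑ ^ 2 := by
  have hX : MeasurableSet {ξ : R3 | ‖(2 * Real.pi) • ξ‖ ≤ 2 * μ} :=
    measurableSet_le (by fun_prop) measurable_const
  rw [← lintegral_const_mul' _ _ ENNReal.ofReal_ne_top, ← lintegral_indicator hX]
  refine lintegral_mono fun ξ ↦ ?_
  by_cases hξ : ξ ∈ {ξ : R3 | ‖(2 * Real.pi) • ξ‖ ≤ 2 * μ}
  · rw [Set.indicator_of_mem hξ]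
    exact enorm_interactionFourier_sq_le hR m μ ε a b t ξ
  · rw [interactionFourier_eq_zero_of_le χ m ε a b t (not_le.1 hξ).le, enorm_zero,
      zero_pow two_ne_zero]
    exact zero_le

theorem lintegral_productFourier_localized_le (χ : Cutoff) {m ε μ l : ℝ} (hl : 1 < l)
    (z : Fin 3 → ℤ) (f b : L2) {X : Set R3} (hX : MeasurableSet X) {M : ℝ≥0∞}
    (hM : ∀ ξ ∈ X, (volume.restrict (shellCube μ l z)).map (bracketSum m ε ξ) ≤ M • volume) :
    ∫⁻ t : ℝ, ∫⁻ ξ in X, ‖productFourier m ε (localized χ μ l z f) b t ξ‖ₑ ^ 2 ≤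
      ENNReal.ofReal (2 * Real.pi) * M * (‖localized χ μ l z f‖ₑ ^ 2 * ‖b‖ₑ ^ 2) := by
  rw [lintegral_lintegral_swap ((stronglyMeasurable_productFourier m ε
    (localized χ μ l z f) b).measurable.enorm.pow_const 2).aemeasurable,
    ← lintegral_enorm_fourier_sq (localized χ μ l z f), ← lintegral_enorm_fourier_sq b]
  exact lintegral_bilinear_oscIntegral_le (Lp.memLp _) (Lp.memLp _) (measurable_bracketSum m ε) hX
    (fourier_localized_eq_zero_of_notMem_shellCube χ μ hl z f) hM

theorem interactionBound_one (χ : Cutoff) (m : ℝ) : ∃ C, 0 < C ∧ ∀ μ l : ℝ, 0 < μ → 20 * μ ≤ l →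
    ∀ (z : Fin 3 → ℤ) (f b : L2),
      InteractionBound χ m μ 1 (localized χ μ l z f) b (C * μ) := by
  obtain ⟨R, hR0, hR⟩ := χ.exists_rho_bound
  refine ⟨√(R ^ 2 * (2 * Real.pi * (8 * (|m| + 6)))), by positivity, fun μ l hμ hμl z f b ↦ ?_⟩
  have hB : 0 ≤ √(R ^ 2 * (2 * Real.pi * (8 * (|m| + 6)))) * μ := by positivity
  rcases lt_or_ge μ 1 with hμ1 | hμ1
  · exact interactionBound_of_fourier_eq_zero hB
      (interactionFourier_eq_zero_of_lt_one χ m 1 hμ1 _ _)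
  refine interactionBound_of_lintegral_le hB ?_
  have hX : MeasurableSet {ξ : R3 | ‖(2 * Real.pi) • ξ‖ ≤ 2 * μ} :=
    measurableSet_le (by fun_prop) measurable_const
  refine (lintegral_mono (lintegral_interactionFourier_le hR m μ 1 _ b)).trans ?_
  rw [lintegral_const_mul' _ _ ENNReal.ofReal_ne_top]
  refine (mul_le_mul_right (lintegral_productFourier_localized_le χ (by linarith) z f b hX
    fun ξ hξ ↦ map_bracketSum_le_of_norm_le m z hμ hμl (by linarith) hξ) _).trans_eq ?_
  rw [← ENNReal.ofReal_mul (by positivity), ← mul_assoc, ← ENNReal.ofReal_mul (by positivity),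
    mul_pow, Real.sq_sqrt (by positivity)]
  congr 2
  ring

theorem lintegral_productFourier_localized_self_le (χ : Cutoff) (m : ℝ) {μ l : ℝ} (hμ : 0 < μ)
    (hμl : 20 * μ ≤ l) (hl : 1 < l) (z : Fin 3 → ℤ) (f : L2) :
    ∫⁻ t : ℝ, ∫⁻ ξ : R3, ‖productFourier m 1 (localized χ μ l z f) (localized χ μ l z f) t ξ‖ₑ ^ 2 ≤
      ENNReal.ofReal (2 * Real.pi * (128 * Real.pi * (|m| + 6) ^ 3) * (μ * l)) *
        (‖localized χ μ l z f‖ₑ ^ 2) ^ 2 := by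
  have h := lintegral_productFourier_localized_le χ hl z f (localized χ μ l z f)
    MeasurableSet.univ fun ξ _ ↦ map_bracketSum_le_mul m z hμ hμl hl.le ξ
  rwa [Measure.restrict_univ, ← ENNReal.ofReal_mul (by positivity), ← mul_assoc (2 * Real.pi),
    ← sq] at h

theorem memLp_top_propagator (m t : ℝ) {a : L2} (ha : Integrable (𝓕 a : L2)) :
    MemLp (propagator m t a) ⊤ := by
  refine memLp_top_of_integrable_fourier ((ha.bdd_mul (c := 1) ?_
    (.of_forall fun ξ ↦ ?_)).congr (coeFn_fourier_propagator m t a).symm)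
  · exact ((measurable_prop_symbol m t).comp (measurable_const_smul _)).aestronglyMeasurable
  · exact (norm_exp_neg_I_mul _).le

theorem lintegral_productFourier_eq (m ε : ℝ) {a : L2} (ha : Integrable (𝓕 a : L2)) (b : L2)
    (t : ℝ) : ∫⁻ ξ : R3, ‖productFourier m ε a b t ξ‖ₑ ^ 2 =
      ∫⁻ x, ‖propagator m t a x‖ₑ ^ 2 * ‖propagator m (ε * t) b x‖ₑ ^ 2 := by
  have h1 : Integrable fun x ↦ propagator m t a x * propagator m (ε * t) b x :=
    (Lp.memLp (propagator m t a)).integrable_mul (Lp.memLp (propagator m (ε * t) b))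
  have h2 : MemLp (fun x ↦ propagator m t a x * propagator m (ε * t) b x) 2 :=
    (Lp.memLp (propagator m (ε * t) b)).mul (memLp_top_propagator m t ha)
  rw [← eLpNorm_two_sq, ← fourier_propagator_mul, eLpNorm_fourier h1 h2, eLpNorm_two_sq]
  simp_rw [enorm_mul, mul_pow]

theorem sq_lintegral_productFourier_le (m ε : ℝ) {a b : L2} (ha : Integrable (𝓕 a : L2))
    (hb : Integrable (𝓕 b : L2)) (t : ℝ) :
    (∫⁻ ξ : R3, ‖productFourier m ε a b t ξ‖ₑ ^ 2) ^ 2 ≤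
      (∫⁻ ξ : R3, ‖productFourier m 1 a a t ξ‖ₑ ^ 2) *
        ∫⁻ ξ : R3, ‖productFourier m 1 b b (ε * t) ξ‖ₑ ^ 2 := by
  simp_rw [lintegral_productFourier_eq m _ ha, lintegral_productFourier_eq m _ hb, one_mul, ← sq]
  exact sq_lintegral_le_of_sq_le_mul
    (((Lp.aestronglyMeasurable _).enorm.pow_const 2).pow_const 2)
    (((Lp.aestronglyMeasurable _).enorm.pow_const 2).pow_const 2) fun x ↦ (mul_pow _ _ _).le

theorem sq_lintegral_lintegral_productFourier_neg_one_le (m : ℝ) {a b : L2}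
    (ha : Integrable (𝓕 a : L2)) (hb : Integrable (𝓕 b : L2)) :
    (∫⁻ t : ℝ, ∫⁻ ξ : R3, ‖productFourier m (-1) a b t ξ‖ₑ ^ 2) ^ 2 ≤
      (∫⁻ t : ℝ, ∫⁻ ξ : R3, ‖productFourier m 1 a a t ξ‖ₑ ^ 2) *
        ∫⁻ t : ℝ, ∫⁻ ξ : R3, ‖productFourier m 1 b b t ξ‖ₑ ^ 2 := by
  have hmeas (c : L2) : Measurable fun t ↦ ∫⁻ ξ : R3, ‖productFourier m 1 c c t ξ‖ₑ ^ 2 :=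
    ((stronglyMeasurable_productFourier m 1 c c).measurable.enorm.pow_const 2).lintegral_prod_right'
  rw [← lintegral_neg_eq_self fun t ↦ ∫⁻ ξ : R3, ‖productFourier m 1 b b t ξ‖ₑ ^ 2]
  refine sq_lintegral_le_of_sq_le_mul (hmeas a).aemeasurable
    ((hmeas b).comp measurable_neg).aemeasurable fun t ↦ ?_
  simpa only [neg_one_mul] using sq_lintegral_productFourier_le m (-1) ha hb t

theorem lintegral_productFourier_neg_one_le (χ : Cutoff) (m : ℝ) {μ l₁ l₂ : ℝ} (hμ : 0 < μ)
    (hμl₁ : 20 * μ ≤ l₁) (hl₁ : 1 < l₁) (hμl₂ : 20 * μ ≤ l₂) (hl₂ : 1 < l₂) (hl : l₂ ≤ 5 * l₁)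
    (z z' : Fin 3 → ℤ) (f g : L2) :
    ∫⁻ t : ℝ, ∫⁻ ξ : R3,
        ‖productFourier m (-1) (localized χ μ l₁ z f) (localized χ μ l₂ z' g) t ξ‖ₑ ^ 2 ≤
      ENNReal.ofReal (2 * Real.pi * (128 * Real.pi * (|m| + 6) ^ 3) * (μ * (5 * l₁))) *
        (‖localized χ μ l₁ z f‖ₑ ^ 2 * ‖localized χ μ l₂ z' g‖ₑ ^ 2) := by
  have hself {l : ℝ} (w : Fin 3 → ℤ) (h : L2) (hμl : 20 * μ ≤ l) (hl1 : 1 < l) (hl5 : l ≤ 5 * l₁) :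
      ∫⁻ t : ℝ, ∫⁻ ξ : R3,
          ‖productFourier m 1 (localized χ μ l w h) (localized χ μ l w h) t ξ‖ₑ ^ 2 ≤
        ENNReal.ofReal (2 * Real.pi * (128 * Real.pi * (|m| + 6) ^ 3) * (μ * (5 * l₁))) *
          (‖localized χ μ l w h‖ₑ ^ 2) ^ 2 := by
    refine (lintegral_productFourier_localized_self_le χ m hμ hμl hl1 w h).trans ?_
    gcongr
  refine (ENNReal.pow_le_pow_left_iff two_ne_zero).1 ?_
  refine (sq_lintegral_lintegral_productFourier_neg_one_le m
    (integrable_fourier_localized χ μ l₁ z f) (integrable_fourier_localized χ μ l₂ z' g)).trans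
    ((mul_le_mul' (hself z f hμl₁ hl₁ (by linarith)) (hself z' g hμl₂ hl₂ hl)).trans_eq ?_)
  ring

theorem interactionBound_neg_one (χ : Cutoff) (m : ℝ) : ∃ C, 0 < C ∧ ∀ μ l₁ l₂ : ℝ, 0 < μ →
    100 * μ ≤ l₁ → ∀ (z z' : Fin 3 → ℤ) (f g : L2), InteractionBound χ m μ (-1)
      (localized χ μ l₁ z f) (localized χ μ l₂ z' g) (C * (μ * l₁) ^ (1 / 2 : ℝ)) := by
  obtain ⟨R, hR0, hR⟩ := χ.exists_rho_bound
  set D : ℝ := R ^ 2 * (2 * Real.pi * (128 * Real.pi * (|m| + 6) ^ 3) * 5) with hD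
  refine ⟨√D, by positivity, fun μ l₁ l₂ hμ hμl₁ z z' f g ↦ ?_⟩
  rw [← Real.sqrt_eq_rpow]
  have hB : 0 ≤ √D * √(μ * l₁) := by positivity
  rcases lt_or_ge μ 1 with hμ1 | hμ1
  · exact interactionBound_of_fourier_eq_zero hB
      (interactionFourier_eq_zero_of_lt_one χ m (-1) hμ1 _ _)
  have hl₁ : 1 < l₁ := by linarith
  rcases lt_or_ge l₂ (20 * μ) with hlow | hlow
  · exact interactionBound_of_fourier_eq_zero hB
      (interactionFourier_eq_zero_of_lt_mul χ m (-1) hl₁ hμl₁ hlow z z' f g)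
  rcases lt_or_ge (5 * l₁) l₂ with hhigh | hhigh
  · exact interactionBound_of_fourier_eq_zero hB
      (interactionFourier_eq_zero_of_mul_lt χ m (-1) hl₁ hμl₁ hhigh z z' f g)
  refine interactionBound_of_lintegral_le hB ?_
  refine (lintegral_mono fun t ↦ lintegral_mono fun ξ ↦
    enorm_interactionFourier_sq_le hR m μ (-1) _ _ t ξ).trans ?_
  simp_rw [lintegral_const_mul' _ _ (ENNReal.ofReal_ne_top (r := R ^ 2))]
  refine (mul_le_mul_right (lintegral_productFourier_neg_one_le χ m hμ (by linarith) hl₁ hlow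
    (by linarith) hhigh z z' f g) _).trans_eq ?_
  rw [← mul_assoc, ← ENNReal.ofReal_mul (by positivity), mul_pow, Real.sq_sqrt (by positivity),
    Real.sq_sqrt (by positivity), hD]
  congr 2
  ring

end Estimates

end DiracBilinear

end

theorem lemma8p1_general (χ : DiracBilinear.Cutoff) (m : ℝ) : ∃ C : ℝ, 0 < C ∧
    ∀ μ l₁ l₂ : ℝ, 0 < μ → 100 * μ ≤ l₁ → ∀ (z z' : Fin 3 → ℤ) (f g : DiracBilinear.L2),
      DiracBilinear.InteractionBound χ m μ 1 (DiracBilinear.localized χ μ l₁ z f)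
        (DiracBilinear.localized χ μ l₂ z' g) (C * μ) ∧
      DiracBilinear.InteractionBound χ m μ (-1) (DiracBilinear.localized χ μ l₁ z f)
        (DiracBilinear.localized χ μ l₂ z' g) (C * (μ * l₁) ^ (1 / 2 : ℝ)) := by
  obtain ⟨C₁, hC₁, hone⟩ := DiracBilinear.interactionBound_one χ m
  obtain ⟨C₂, hC₂, hneg⟩ := DiracBilinear.interactionBound_neg_one χ m
  refine ⟨C₁ + C₂, by positivity, fun μ l₁ l₂ hμ hμl₁ z z' f g ↦ ⟨?_, ?_⟩⟩
  · exact (hone μ l₁ hμ (by linarith) z f _).mono (by gcongr; linarith)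
  · have hl₁ : 0 < l₁ := by linarith
    exact (hneg μ l₁ l₂ hμ hμl₁ z z' f g).mono (by gcongr; linarith)

theorem lemma8p1 :
    ∃ N : ℝ, 1 < N ∧
      ∀ (χ : DiracBilinear.Cutoff) (m : ℝ), 0 ≤ m → ∀ K : ℝ, 1 ≤ K →
        ∃ C : ℝ, 0 < C ∧
          ∀ μ l₁ l₂ : ℝ, DiracBilinear.IsDyadic μ → DiracBilinear.IsDyadic l₁ →
            DiracBilinear.IsDyadic l₂ →
            N * μ ≤ l₁ → l₁ ≤ K * l₂ → l₂ ≤ K * l₁ →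
            ∀ (z z' : Fin 3 → ℤ) (f g : DiracBilinear.L2),
              (MemLp (DiracBilinear.interaction χ m μ 1
                    (DiracBilinear.localized χ μ l₁ z f)
                    (DiracBilinear.localized χ μ l₂ z' g)) 2 volume ∧
                eLpNorm (DiracBilinear.interaction χ m μ 1
                    (DiracBilinear.localized χ μ l₁ z f)
                    (DiracBilinear.localized χ μ l₂ z' g)) 2 volume ≤
                  ENNReal.ofReal (C * μ * ‖DiracBilinear.localized χ μ l₁ z f‖ *
                    ‖DiracBilinear.localized χ μ l₂ z' g‖)) ∧
              (MemLp (DiracBilinear.interaction χ m μ (-1)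
                    (DiracBilinear.localized χ μ l₁ z f)
                    (DiracBilinear.localized χ μ l₂ z' g)) 2 volume ∧
                eLpNorm (DiracBilinear.interaction χ m μ (-1)
                    (DiracBilinear.localized χ μ l₁ z f)
                    (DiracBilinear.localized χ μ l₂ z' g)) 2 volume ≤
                  ENNReal.ofReal (C * (μ * l₁) ^ (1 / 2 : ℝ) *
                    ‖DiracBilinear.localized χ μ l₁ z f‖ *
                    ‖DiracBilinear.localized χ μ l₂ z' g‖)) := by
  refine ⟨100, by norm_num, fun χ m _ K _ ↦ (lemma8p1_general χ m).imp fun C hC ↦ ⟨hC.1, ?_⟩⟩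
  exact fun μ l₁ l₂ ⟨k, hk⟩ _ _ hμl₁ _ _ ↦ hC.2 μ l₁ l₂ (hk ▸ by positivity) hμl₁
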